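/- **Trees and substitutions.** Let $\mathcal X$ and $\Sigma$ be finite ranked alphabets (not necessarily disjoint, with a common rank function $\mathrm{rk}$), and let $H=\{1,\dots,|H|\}$ be a set of holes of rank $0$, disjoint from $\Sigma\cup\mathcal X$, with $\mathrm{rk}(x)\le |H|$ for all $x\in\Sigma\cup\mathcal X$. $T(\Delta)$ denotes the set of finite and infinite (well-ranked, ordered) trees over a ranked alphabet $\Delta$, $H(t)$ is the set of holes occurring in $t$, and $t[i_j\leftarrow t_i]$ is obtained from $t$ by replacing every leaf labelled $i\in H$ by the same tree $t_i$. A *substitution* is a map $\sigma:\mathcal X\to 2^{T(\Sigma\cup H)\setminus H}$ with $\sigma(x)\subseteq T(\Sigma\cup\{1,\dots,\mathrm{rk}(x)\})$; put $\sigma(f)=\{f(1,\dots,\mathrm{rk}(f))\}$ for $f\in\Sigma\setminus\mathcal X$. For $s\in T(\Sigma\cup\mathcal X)$ let $\Gamma(\sigma,s)$ be the set of maps $\gamma$ on the positions of $s$ such that $\gamma(u)\in\sigma(s(u))$ if $\sigma(s(u))\ne\emptyset$, and $\gamma(u)=\bot$ otherwise. Let $\gamma_0(s)=\gamma(\varepsilon)$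 and $\gamma_n(s)=\gamma(\varepsilon)[i_j\leftarrow(\gamma|_i)_{n-1}(s|_i)]$ for $n\ge1$, where every tree containing $\bot$ is identified with $\bot$, and $\gamma_\infty(s)=\lim_n\gamma_n(s)$ in the usual tree metric, with $\bot$ an isolated point. Then $\sigma_{\mathrm{io}}(s)=\{\gamma_\infty(s)\mid\gamma\in\Gamma(\sigma,s)\}\setminus\{\bot\}$. The same definitions are used with a larger alphabet in place of $\Sigma$ in the trees that are substituted. **Automata and profiles.** Let $B=(Q,\Sigma,\delta,\chi)$ be a nondeterministic top-down parity tree automaton with finite $Q\neq\emptyset$, $\chi:Q\to C=\{1,\dots,|C|\}$, $|C|$ odd; a run is accepting if on every infinite path the least color that occurs infinitely often is even; $L(B,p)$ is the set of trees having an accepting run with root state $p$. Let $q_0\in Q$. Let $B_H=(Q,\Sigma\cup H,\delta\cup(Q\times H),\chi)$. Let $0\preceq2\preceq4\preceq\dots\preceq|C|-1\preceq|C|\preceq|C|-2\preceq\dots\preceq3\preceq1$. A *task* is a tuple $\tau=(p,\psi_1,\dots,\psi_{|H|})$ with $p\in Q$ and $\psi_i:Q\to\{0\}\cup\chi(Q)$.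 A tree $t\in T(\Sigma\cup H)$ satisfies $\tau$ if $B_H$ has an accepting run $\rho$ on $t$ with root state $p$ such that for every $i\in H$ and every leaf $v$ of $t$ labelled $i$, the least color $c$ on the path from the root to $v$ (ends included) satisfies $c\preceq\psi_i(\rho(v))$. The *profile* $\pi(t)$ is the set of tasks satisfied by $t$, and $\pi(\bot)=\emptyset$; let $\mathcal P$ be the set of all profiles $\pi(t)$, $t\in T(\Sigma\cup H)\cup\{\bot\}$. If $\pi=\pi(t)\neq\emptyset$ then $H(t)$ depends on $\pi$ only; write $H(\pi)=H(t)$, and $H(\emptyset)=\emptyset$. **The automaton $B_{\mathcal P}$.** $\Sigma_{\mathcal P}$ consists of $\Sigma$, new symbols $\$_i$ of rank $1$ for $i\in H$, and new symbols $f_\pi$ of rank $|Q\times H(\pi)|$ for $\pi\in\mathcal P$. $B_{\mathcal P}$ is the parity automaton over $\Sigma_{\mathcal P}\cup H$ with states $Q\cup(C\times Q\times H)$, coloring $\chi$ extended by $(c,q,i)\mapsto c$, and as transitions those of $B_H$, all $((c,q,i),\$_i,q)$, and, for all $\pi\in\mathcal P$ and $(p,\psi_1,\dots,\psi_{|H|})\in\pi$,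 all $(p,f_\pi,p_1,\dots,p_k)$ with $k=|Q\times H(\pi)|$ and $\{p_1,\dots,p_k\}=\{(\psi_i(q),q,i)\mid q\in Q,\ i\in H(\pi),\ \psi_i(q)\ne0\}$. Let $t_\pi$ be the finite tree with root $f_\pi$ whose children are, in some fixed order, $|Q|$ copies of $\$_i(i)$ for each $i\in H(\pi)$ (so it is the constant $f_\pi$ if $H(\pi)=\emptyset$). The *specialization* of $\sigma$ is $\check\sigma(x)=\{t_{\pi(t)}\mid t\in\sigma(x)\}$. **Proposition.** For every substitution $\sigma:\mathcal X\to2^{T(\Sigma\cup H)\setminus H}$, $$\{s\in T(\Sigma\cup\mathcal X)\mid\check\sigma_{\mathrm{io}}(s)\subseteq L(B_{\mathcal P},q_0)\}\subseteq\{s\in T(\Sigma\cup\mathcal X)\mid\sigma_{\mathrm{io}}(s)\subseteq L(B,q_0)\}.$$ Moreover, the two sets are equal provided that $\sigma(x)\neq\emptyset$ for all $x\in\mathcal X$, or that every tree in $\bigcup_{x\in\mathcal X}\sigma(x)$ in which a hole occurs has a nonempty profile. -/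

import Mathlib

/-! ### Ranked alphabets and finite or infinite trees -/

/-- A set of symbols together with a rank function. -/
class RankedAlphabet (α : Type*) where
  rk : α → ℕ

open RankedAlphabet

/-- Symbols taken from a subset keep their rank. -/
instance rankedSubtype {α : Type*} [RankedAlphabet α] (S : Set α) : RankedAlphabet S where
  rk x := rk x.1

/-- The alphabet `α ∪ H` with `H = Fin h`: every hole has rank `0`. -/
instance rankedHoles {α : Type*} [RankedAlphabet α] (h : ℕ) : RankedAlphabet (α ⊕ Fin h) where
  rk := Sum.elim rk (fun _ => 0)

/-- A finite or infinite tree over a ranked alphabet, as a partial labelling of the positions.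
A position is a list of directions, read from the root. Directions are counted from `0`, so a
vertex labelled `a` has exactly the children `0, …, rk a - 1`; accordingly the holes are the
elements `0, …, h - 1` of `Fin h`. The value `none` marks the lists that are not positions. -/
@[ext]
structure RTree (α : Type*) [RankedAlphabet α] where
  lab : List ℕ → Option α
  root : (lab []).isSome
  child : ∀ (u : List ℕ) (i : ℕ), (lab (u ++ [i])).isSome ↔ ∃ a, lab u = some a ∧ i < rk a

namespace RTree

variable {α : Type*} [RankedAlphabet α] {h : ℕ}

/-- The set of positions of a tree. -/
def pos (t : RTree α) : Set (List ℕ) := {u | (t.lab u).isSome}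

/-- The set `H(t)` of holes that occur in `t`. -/
def holes (t : RTree (α ⊕ Fin h)) : Set (Fin h) := {i | ∃ u, t.lab u = some (Sum.inr i)}

/-- A tree without holes, seen as a tree over the alphabet with holes. -/
def addHoles (h : ℕ) (t : RTree α) : RTree (α ⊕ Fin h) where
  lab u := (t.lab u).map Sum.inl
  root := by simpa using t.root
  child u i := by
    have := t.child u i
    simp only [Option.isSome_map, this, Option.map_eq_some_iff]
    constructor
    · rintro ⟨a, ha, hi⟩
      exact ⟨Sum.inl a, ⟨a, ha, rfl⟩, hi⟩
    · rintro ⟨_, ⟨a, ha, rfl⟩, hi⟩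
      exact ⟨a, ha, hi⟩

/-- The tree that consists of the hole `i` only. -/
def hole (i : Fin h) : RTree (α ⊕ Fin h) where
  lab
    | [] => some (Sum.inr i)
    | _ :: _ => none
  root := rfl
  child u j := by
    cases u <;> simp [rk]

/-- The tree `f(1, …, rk f)`. -/
def op (f : α) (hf : rk f ≤ h) : RTree (α ⊕ Fin h) where
  lab
    | [] => some (Sum.inl f)
    | [k] => if hk : k < rk f then some (Sum.inr ⟨k, hk.trans_le hf⟩) else none
    | _ :: _ :: _ => none
  root := rfl
  child u j := by
    rcases u with _ | ⟨k, _ | ⟨l, u⟩⟩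
    · by_cases hj : j < rk f <;> simp [hj, rk]
    · by_cases hk : k < rk f <;> simp [hk, rk]
    · simp

/-- The labelling of `t[i_j ← r i]`: walk down `t` until a hole `i` is met, and then continue
in `r i`. -/
def graftLab (r : Fin h → RTree (α ⊕ Fin h)) :
    List ℕ → (List ℕ → Option (α ⊕ Fin h)) → Option (α ⊕ Fin h)
  | [], l =>
    match l [] with
    | some (Sum.inr i) => (r i).lab []
    | o => o
  | k :: v, l =>
    match l [] with
    | some (Sum.inr i) => (r i).lab (k :: v)
    | _ => graftLab r v (fun w => l (k :: w))

theorem graftLab_child (r : Fin h → RTree (α ⊕ Fin h)) (i : ℕ) :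
    ∀ (u : List ℕ) (l : List ℕ → Option (α ⊕ Fin h)),
      (∀ (u : List ℕ) (i : ℕ), (l (u ++ [i])).isSome ↔ ∃ a, l u = some a ∧ i < rk a) →
      ((graftLab r (u ++ [i]) l).isSome ↔ ∃ a, graftLab r u l = some a ∧ i < rk a) := by
  intro u
  induction u with
  | nil =>
    intro l hl
    have h0 := hl [] i
    rcases hl0 : l [] with _ | a | j
    · simp only [hl0, List.nil_append] at h0
      have h1 : l [i] = none := by simpa using h0
      simp [graftLab, hl0, h1]
    · simp only [hl0, List.nil_append] at h0
      rcases h1 : l [i] with _ | b | j'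
      · simp only [h1] at h0
        simpa [graftLab, hl0, h1] using h0
      · simp only [h1] at h0
        simpa [graftLab, hl0, h1] using h0
      · simp only [h1] at h0
        have h2 : i < rk (Sum.inl a : α ⊕ Fin h) := by simpa using h0
        simp [graftLab, hl0, h1, h2, (r j').root]
    · have := (r j).child [] i
      simpa [graftLab, hl0] using this
  | cons k v ih =>
    intro l hl
    rcases hl0 : l [] with _ | a | j
    · simpa [graftLab, hl0] using ih (fun w => l (k :: w)) (fun u i => by simpa using hl (k :: u) i)
    · simpa [graftLab, hl0] using ih (fun w => l (k :: w)) (fun u i => by simpa using hl (k :: u) i)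
    · have := (r j).child (k :: v) i
      simpa [graftLab, hl0] using this

/-- The tree `t[i_j ← r i]`: every leaf of `t` that is labelled by a hole `i` is replaced by the
same tree `r i`. -/
def graft (t : RTree (α ⊕ Fin h)) (r : Fin h → RTree (α ⊕ Fin h)) : RTree (α ⊕ Fin h) where
  lab u := graftLab r u t.lab
  root := by
    have := t.root
    rcases h0 : t.lab [] with _ | a | i
    · simp [h0] at this
    · simp [graftLab, h0]
    · simpa [graftLab, h0] using (r i).root
  child u i := graftLab_child r i u t.lab t.child

/-- The distance on `T_⊥`, the set of trees together with an isolated point `⊥` (here `none`):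
`2 ^ (-n)` with `n` the least level at which the two trees have a common position with different
labels, and `0` if there is no such position. -/
noncomputable def distBot : Option (RTree α) → Option (RTree α) → ℝ
  | none, none => 0
  | some s, some t =>
    let N : Set ℕ := {n | ∃ u a b, u.length = n ∧ s.lab u = some a ∧ t.lab u = some b ∧ a ≠ b}
    open scoped Classical in if N = ∅ then 0 else (1 / 2 : ℝ) ^ sInf N
  | _, _ => 1

/-- Substitution into the holes in `T_⊥`: the result is `⊥` as soon as `⊥` occurs in it. -/
noncomputable def graftBot :
    Option (RTree (α ⊕ Fin h)) → (Fin h → Option (RTree (α ⊕ Fin h))) →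
      Option (RTree (α ⊕ Fin h))
  | none, _ => none
  | some t, r =>
    open scoped Classical in
    if ∀ i ∈ t.holes, (r i).isSome then some (t.graft fun i => (r i).getD (hole i)) else none

end RTree

/-! ### Substitutions and their inside-out extension -/

section Substitution

variable {Λ α : Type*} [RankedAlphabet Λ] [RankedAlphabet α] {h : ℕ}

/-- `σ(x) ⊆ T(Σ ∪ {1, …, rk x}) ∖ H` for all variables `x`. -/
def IsSubstitution (σ : Λ → Set (RTree (α ⊕ Fin h))) : Prop :=
  ∀ x, ∀ t ∈ σ x, (∀ i ∈ t.holes, (i : ℕ) < rk x) ∧ ∀ i : Fin h, t.lab [] ≠ some (Sum.inr i)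

/-- The extension of a mapping `σ` on the variables to the symbols in `S ∪ X`, by
`σ(f) = {f(1, …, rk f)}` for `f ∈ S ∖ X`. The map `ι` embeds `S` into the alphabet of the trees
that `σ` substitutes. -/
noncomputable def extendSubst {Ω : Type*} [RankedAlphabet Ω] {S X : Set Ω} (ι : S → α)
    (hι : ∀ f, rk (ι f) ≤ h) (σ : X → Set (RTree (α ⊕ Fin h))) :
    ↥(S ∪ X) → Set (RTree (α ⊕ Fin h)) := fun z =>
  open scoped Classical in
  if hx : z.1 ∈ X then σ ⟨z.1, hx⟩
  else {RTree.op (ι ⟨z.1, z.2.resolve_right hx⟩) (hι _)}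

/-- `γ ∈ Γ(σ, s)`: at a position of `s` with label `x`, the choice function `γ` selects an
element of `σ(x)` if there is one, and `⊥` (that is `none`) otherwise.
The values of `γ` outside of the positions of `s` play no role. -/
def IsChoice (σ : Λ → Set (RTree (α ⊕ Fin h))) (s : RTree Λ)
    (γ : List ℕ → Option (RTree (α ⊕ Fin h))) : Prop :=
  ∀ u x, s.lab u = some x → (∃ t ∈ σ x, γ u = some t) ∨ (σ x = ∅ ∧ γ u = none)

/-- The sequence `γ_n(s)`: `γ_0(s) = γ(ε)` and `γ_{n+1}(s) = γ(ε)[i_j ← (γ|_i)_n(s|_i)]`. -/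
noncomputable def choiceStage :
    ℕ → (List ℕ → Option (RTree (α ⊕ Fin h))) → Option (RTree (α ⊕ Fin h))
  | 0, γ => γ []
  | n + 1, γ => RTree.graftBot (γ []) fun i => choiceStage n fun v => γ ((i : ℕ) :: v)

/-- The inside-out extension: the set of all `γ_∞(s) = lim γ_n(s)` different from `⊥`, with
`γ ∈ Γ(σ, s)`. -/
def ioExt (σ : Λ → Set (RTree (α ⊕ Fin h))) (s : RTree Λ) : Set (RTree (α ⊕ Fin h)) :=
  {t | ∃ γ, IsChoice σ s γ ∧
    Filter.Tendsto (fun n => RTree.distBot (choiceStage n γ) (some t)) Filter.atTop (nhds 0)}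

end Substitution

/-! ### Parity automata, tasks and profiles -/

/-- A nondeterministic top-down tree automaton with a parity condition; the set of colors is
`{1, …, numColors}`, with an odd number of colors. -/
structure ParityNTA (Q : Type*) (α : Type*) [RankedAlphabet α] where
  numColors : ℕ
  odd_numColors : Odd numColors
  δ : Q → (f : α) → (Fin (rk f) → Q) → Prop
  χ : Q → Set.Icc 1 numColors

namespace ParityNTA

variable {Q α : Type*} [RankedAlphabet α]

/-- A run on `t` (only the values of `ρ` at the positions of `t` matter). -/
def IsRun (A : ParityNTA Q α) (t : RTree α) (ρ : List ℕ → Q) : Prop :=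
  ∀ u f, t.lab u = some f → A.δ (ρ u) f (fun j => ρ (u ++ [(j : ℕ)]))

/-- On every infinite directed path the minimal color that appears infinitely often is even. -/
def IsAccepting (A : ParityNTA Q α) (t : RTree α) (ρ : List ℕ → Q) : Prop :=
  ∀ u : ℕ → List ℕ, (∀ k, u k ∈ t.pos) → (∀ k, ∃ i, u (k + 1) = u k ++ [i]) →
    ∃ c : ℕ, Even c ∧ IsLeast {c | ∃ᶠ k in Filter.atTop, (A.χ (ρ (u k)) : ℕ) = c} c

/-- `ρ ∈ Run_A(t, p)`. -/
def AcceptingRun (A : ParityNTA Q α) (t : RTree α) (p : Q) (ρ : List ℕ → Q) : Prop :=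
  A.IsRun t ρ ∧ A.IsAccepting t ρ ∧ ρ [] = p

/-- The language `L(A, p)`. -/
def lang (A : ParityNTA Q α) (p : Q) : Set (RTree α) := {t | ∃ ρ, A.AcceptingRun t p ρ}

/-- The automaton `B_H`, which in addition accepts every hole at every state. -/
def withHoles (B : ParityNTA Q α) (h : ℕ) : ParityNTA Q (α ⊕ Fin h) where
  numColors := B.numColors
  odd_numColors := B.odd_numColors
  δ q a :=
    match a with
    | Sum.inl f => fun p => B.δ q f p
    | Sum.inr _ => fun _ => True
  χ := B.χ

/-- The best-ordering
`0 ⪯ 2 ⪯ 4 ⪯ ⋯ ⪯ 5 ⪯ 3 ⪯ 1` on the set consisting of `0` and the colors. -/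
def BestLE (a b : ℕ) : Prop :=
  (Even a ∧ Odd b) ∨ (Even a ∧ Even b ∧ a ≤ b) ∨ (Odd a ∧ Odd b ∧ b ≤ a)

/-- The minimal color on the path from the root to the position `v` (both ends included). -/
noncomputable def minColor (B : ParityNTA Q α) (ρ : List ℕ → Q) (v : List ℕ) : ℕ :=
  sInf {c : ℕ | ∃ w, w <+: v ∧ c = B.χ (ρ w)}

/-- A task `(p, ψ_1, …, ψ_h)` with `ψ_i : Q → {0} ∪ χ(Q)`. -/
structure Task (B : ParityNTA Q α) (h : ℕ) where
  state : Q
  ψ : Fin h → Q → ℕ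
  mem : ∀ i q, ψ i q = 0 ∨ ∃ q', ψ i q = B.χ q'

/-- `ρ ⊨ τ`. -/
def Satisfies (B : ParityNTA Q α) {h : ℕ} (t : RTree (α ⊕ Fin h)) (ρ : List ℕ → Q)
    (τ : B.Task h) : Prop :=
  ∀ v i, t.lab v = some (Sum.inr i) → BestLE (B.minColor ρ v) (τ.ψ i (ρ v))

/-- The profile `π(t)`: the set of all tasks `τ` with `t ⊨ τ`. -/
def profile (B : ParityNTA Q α) {h : ℕ} (t : RTree (α ⊕ Fin h)) : Set (B.Task h) :=
  {τ | ∃ ρ, (B.withHoles h).AcceptingRun t τ.state ρ ∧ B.Satisfies t ρ τ}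

/-- The set of profiles of trees. The empty profile always belongs to it, because it is
the profile of the tree `⊥`. -/
def profiles (B : ParityNTA Q α) (h : ℕ) : Set (Set (B.Task h)) :=
  insert ∅ (Set.range fun t : RTree (α ⊕ Fin h) => B.profile t)

/-- The set `H(t)` as a function of the profile `π = π(t)`, for `π ≠ ∅`; it does not depend on
the choice of `t` by `profHoles_profile`. For `π = ∅` it is empty. -/
def profHoles (B : ParityNTA Q α) {h : ℕ} (π : Set (B.Task h)) : Set (Fin h) :=
  {i | π ≠ ∅ ∧ ∃ t : RTree (α ⊕ Fin h), B.profile t = π ∧ i ∈ t.holes}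

theorem profHoles_profile (B : ParityNTA Q α) {h : ℕ} (t : RTree (α ⊕ Fin h))
    (ht : B.profile t ≠ ∅) : B.profHoles (B.profile t) = t.holes := by
  ext i
  refine ⟨?_, fun hi => ⟨ht, t, rfl, hi⟩⟩
  rintro ⟨-, t', htt, v, hv⟩
  by_contra hi
  obtain ⟨τ, ρ, hρ, hsat⟩ := Set.nonempty_iff_ne_empty.mpr ht
  classical
  let τ' : B.Task h :=
    { state := τ.state
      ψ := fun j q => if j = i then 0 else τ.ψ j q
      mem := fun j q => by
        by_cases hj : j = i
        · simp [hj]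
        · simpa [hj] using τ.mem j q }
  have h1 : τ' ∈ B.profile t := by
    refine ⟨ρ, hρ, fun w j hw => ?_⟩
    have hj : j ≠ i := by
      rintro rfl
      exact hi ⟨w, hw⟩
    simpa [τ', hj] using hsat w j hw
  rw [← htt] at h1
  obtain ⟨ρ', -, hsat'⟩ := h1
  have h2 : BestLE (B.minColor ρ' v) 0 := by simpa [τ'] using hsat' v i hv
  have h3 : B.minColor ρ' v ∈ {c : ℕ | ∃ w, w <+: v ∧ c = B.χ (ρ' w)} :=
    Nat.sInf_mem ⟨_, v, List.prefix_rfl, rfl⟩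
  obtain ⟨w, -, hw⟩ := h3
  have h4 := (B.χ (ρ' w)).2.1
  rcases h2 with ⟨-, h2⟩ | ⟨-, -, h2⟩ | ⟨-, h2, -⟩
  · simp at h2
  · omega
  · simp at h2

/-! ### The extended alphabet, the extended automaton and the trees `t_π` -/

/-- The alphabet `Σ_P`: the old symbols, a symbol `$_i` for every hole `i`, and a symbol `f_π`
for every profile `π`. -/
inductive ProfAlphabet (B : ParityNTA Q α) (h : ℕ)
  | base (f : α)
  | dollar (i : Fin h)
  | prof (π : B.profiles h)

/-- The symbol `$_i` has rank `1`, and `f_π` has rank `|Q × H(t)|` where `π = π(t)`; in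
particular `f_∅` is a constant. -/
noncomputable instance (B : ParityNTA Q α) (h : ℕ) : RankedAlphabet (B.ProfAlphabet h) where
  rk
    | .base f => rk f
    | .dollar _ => 1
    | .prof π => Nat.card (Q × B.profHoles π.1)

/-- The automaton `B_P`, with set of states `Q ∪ (C × Q × H)`. It has the transitions of `B_H`,
the transitions `((c, q, i), $_i, q)`, and for every `τ = (p, ψ_1, …, ψ_h) ∈ π` all transitions
`(p, f_π, …)` such that the set of the successor states is
`{(ψ_i(q), q, i) | q ∈ Q, i ∈ H(t), ψ_i(q) ≠ 0}` where `π = π(t)`. -/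
noncomputable def profAutomaton (B : ParityNTA Q α) (h : ℕ) :
    ParityNTA (Q ⊕ (Set.Icc 1 B.numColors × Q × Fin h)) (B.ProfAlphabet h ⊕ Fin h) where
  numColors := B.numColors
  odd_numColors := B.odd_numColors
  δ r a :=
    match a with
    | Sum.inl (.base f) => fun p =>
        ∃ q p', r = Sum.inl q ∧ (∀ j, p j = Sum.inl (p' j)) ∧ B.δ q f p'
    | Sum.inl (.dollar i) => fun p =>
        ∃ c q, r = Sum.inr (c, q, i) ∧ ∀ j, p j = Sum.inl q
    | Sum.inl (.prof π) => fun p =>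
        ∃ τ ∈ π.1, r = Sum.inl τ.state ∧
          Set.range p = {r' | ∃ i ∈ B.profHoles π.1, ∃ q, ∃ c : Set.Icc 1 B.numColors,
            τ.ψ i q ≠ 0 ∧ (c : ℕ) = τ.ψ i q ∧ r' = Sum.inr (c, q, i)}
    | Sum.inr _ => fun _ => ∃ q, r = Sum.inl q
  χ := Sum.elim B.χ (fun r => r.1)

/-- The tree `t_π`. The children of the root `f_π` are indexed, in some fixed order, by
`Q × H(t)` where `π = π(t)`; the child with index `(q, i)` is labelled `$_i` and its only child
is the hole `i`. -/
noncomputable def profTree [Finite Q] (B : ParityNTA Q α) {h : ℕ} (π : B.profiles h) :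
    RTree (B.ProfAlphabet h ⊕ Fin h) where
  lab
    | [] => some (Sum.inl (.prof π))
    | [k] => if hk : k < Nat.card (Q × B.profHoles π.1) then
        some (Sum.inl (.dollar ((Finite.equivFin (Q × B.profHoles π.1)).symm ⟨k, hk⟩).2)) else none
    | [k, l] => if hk : k < Nat.card (Q × B.profHoles π.1) ∧ l = 0 then
        some (Sum.inr ((Finite.equivFin (Q × B.profHoles π.1)).symm ⟨k, hk.1⟩).2) else none
    | _ :: _ :: _ :: _ => none
  root := rfl
  child u j := by
    rcases u with _ | ⟨k, _ | ⟨l, _ | ⟨m, u⟩⟩⟩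
    · by_cases hj : j < Nat.card (Q × B.profHoles π.1) <;>
        simp only [List.nil_append, hj, dite_true, dite_false, Option.isSome_some, Option.isSome_none,
          Option.some.injEq, exists_eq_left', true_iff, false_iff, Bool.false_eq_true] <;>
        exact hj
    · by_cases hk : k < Nat.card (Q × B.profHoles π.1) <;> by_cases hj : j = 0 <;>
        simp [hj, rk]
    · by_cases hk : k < Nat.card (Q × B.profHoles π.1) ∧ l = 0 <;> simp [hk, rk]
    · simp

/-- The specialization `σ̌` of `σ`: `σ̌(x) = {t_π | ∃ t ∈ σ(x), π = π(t)}`. -/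
noncomputable def specialization [Finite Q] (B : ParityNTA Q α) {h : ℕ} {X : Type*}
    (σ : X → Set (RTree (α ⊕ Fin h))) : X → Set (RTree (B.ProfAlphabet h ⊕ Fin h)) := fun x =>
  {t' | ∃ π : B.profiles h, (∃ t ∈ σ x, π.1 = B.profile t) ∧ t' = B.profTree π}

end ParityNTA

/-! ### Positions of grafted trees, and agreement up to a level in the tree metric -/

namespace RTree

variable {α : Type*} [RankedAlphabet α] {h : ℕ}

/-! The tree `γ_∞(s)` is composed of pieces: start with the piece `γ(ε)`, and at every leaf `i` of a
copy of the piece `γ(u)` continue with a copy of `γ(u i)`. Only the positions `u` reached in this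
way matter (`Reach`). If all their pieces exist and none is a bare hole (`Guarded`), the stages
`γ_n(s)` converge to this composition.

A choice `γ` for `σ` is matched with a choice `γ'` for its specialization that uses `t_π`, `π =
π(t)`, where `γ` uses `t`. A copy of `t_π` in an accepted tree makes `B_P` pick a task of `π`, and a
run on `t` that satisfies this task can be inserted. Conversely, the part of an accepting run lying
in a copy of `t` satisfies a least task, and this task prescribes a run on `t_π`. Copies of one
piece may need different runs, so runs are attached to occurrences and not to the positions of `s`.

Both directions are instances of `exists_acceptingRun_of_simulation`. An infinite path of a composed
tree either finally stays in one piece, where the local run is accepting, or it crosses infinitely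
many pieces. In the second case it is matched with a path of the other tree so that, segment by
segment, its minimal color is `⪯` the minimal color there. By `even_of_bestLE` this preserves the
parity condition.

The two sets can differ only because of `⊥`. If a piece with holes has empty profile, `t_∅` is a
constant and hides the pieces below it, so `γ'` may have a limit while `γ` yields `⊥`. The inclusion
is unaffected, since the pieces reached by `γ'` are always reached by `γ`. Equality needs that no
contributing piece of `γ` is missing, and each of the two extra assumptions ensures this. -/

theorem isSome_of_append (t : RTree α) {u v : List ℕ} (huv : (t.lab (u ++ v)).isSome) :
    (t.lab u).isSome := by
  induction v using List.reverseRecOn with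
  | nil => simpa using huv
  | append_singleton v k ih =>
    rw [← List.append_assoc, t.child] at huv
    obtain ⟨a, ha, -⟩ := huv
    exact ih (by simp [ha])

/-- Holes are leaves. -/
theorem eq_nil_of_hole (t : RTree (α ⊕ Fin h)) {u v : List ℕ} {i : Fin h}
    (hu : t.lab u = some (Sum.inr i)) (huv : (t.lab (u ++ v)).isSome) : v = [] := by
  rcases v with _ | ⟨k, v⟩
  · rfl
  · have h1 : (t.lab (u ++ [k])).isSome := by
      apply t.isSome_of_append (v := v)
      simpa using huv
    rw [t.child] at h1
    obtain ⟨a, ha, hk⟩ := h1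
    rw [hu] at ha
    obtain rfl : Sum.inr i = a := by simpa using ha
    simp [rk] at hk

/-- Stated for arbitrary labellings, since the induction passes to `fun w => l (k :: w)`, which need
not come with a tree structure. -/
theorem graftLab_of_hole (r : Fin h → RTree (α ⊕ Fin h)) (i : Fin h) (w : List ℕ) :
    ∀ (v : List ℕ) (l : List ℕ → Option (α ⊕ Fin h)), l v = some (Sum.inr i) →
      (∀ v' j, v' <+: v → v' ≠ v → l v' ≠ some (Sum.inr j)) →
      graftLab r (v ++ w) l = (r i).lab w := by
  intro v
  induction v with
  | nil =>
    intro l hl _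
    cases w <;> simp [graftLab, hl]
  | cons k v ih =>
    intro l hl hne
    have h0 : ∀ j, l [] ≠ some (Sum.inr j) := fun j => hne [] j (by simp) (by simp)
    have h1 : graftLab r (v ++ w) (fun w => l (k :: w)) = (r i).lab w :=
      ih _ hl fun v' j hv' hv => hne (k :: v') j (by simpa using hv') (by simpa using hv)
    rcases hl0 : l [] with _ | a | j
    · simpa [graftLab, hl0] using h1
    · simpa [graftLab, hl0] using h1
    · exact absurd hl0 (h0 j)

theorem graftLab_of_noHole (r : Fin h → RTree (α ⊕ Fin h)) :
    ∀ (w : List ℕ) (l : List ℕ → Option (α ⊕ Fin h)),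
      (∀ v j, v <+: w → l v ≠ some (Sum.inr j)) → graftLab r w l = l w := by
  intro w
  induction w with
  | nil =>
    intro l hne
    have h0 : ∀ j, l [] ≠ some (Sum.inr j) := fun j => hne [] j (by simp)
    rcases hl0 : l [] with _ | a | j
    · simp [graftLab, hl0]
    · simp [graftLab, hl0]
    · exact absurd hl0 (h0 j)
  | cons k w ih =>
    intro l hne
    have h0 : ∀ j, l [] ≠ some (Sum.inr j) := fun j => hne [] j (by simp)
    have h1 := ih (fun w => l (k :: w)) fun v j hv => hne (k :: v) j (by simpa using hv)
    rcases hl0 : l [] with _ | a | j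
    · simpa [graftLab, hl0] using h1
    · simpa [graftLab, hl0] using h1
    · exact absurd hl0 (h0 j)

theorem graft_of_hole (t : RTree (α ⊕ Fin h)) (r : Fin h → RTree (α ⊕ Fin h)) {v : List ℕ}
    {i : Fin h} (hv : t.lab v = some (Sum.inr i)) (w : List ℕ) :
    (t.graft r).lab (v ++ w) = (r i).lab w := by
  refine graftLab_of_hole r i w v t.lab hv ?_
  rintro v' j ⟨w', rfl⟩ hne hj
  have := t.eq_nil_of_hole hj (v := w') (by simp [hv])
  exact hne (by simp [this])

theorem graft_of_noHole (t : RTree (α ⊕ Fin h)) (r : Fin h → RTree (α ⊕ Fin h)) {w : List ℕ}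
    (hw : ∀ v j, v <+: w → t.lab v ≠ some (Sum.inr j)) : (t.graft r).lab w = t.lab w :=
  graftLab_of_noHole r w t.lab hw

/-- Two trees without conflicting labels up to some level agree up to this level. -/
theorem lab_eq_of_agree {s t : RTree α} {n : ℕ}
    (hst : ∀ u a b, u.length ≤ n → s.lab u = some a → t.lab u = some b → a = b) :
    ∀ u, u.length ≤ n → s.lab u = t.lab u := by
  intro u
  induction u using List.reverseRecOn with
  | nil =>
    intro hn
    obtain ⟨a, ha⟩ := Option.isSome_iff_exists.mp s.root
    obtain ⟨b, hb⟩ := Option.isSome_iff_exists.mp t.root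
    rw [ha, hb, hst [] a b hn ha hb]
  | append_singleton u k ih =>
    intro hn
    have h1 := ih (by simp at hn; omega)
    have h2 : (s.lab (u ++ [k])).isSome ↔ (t.lab (u ++ [k])).isSome := by
      rw [s.child, t.child, h1]
    rcases hs : s.lab (u ++ [k]) with _ | a
    · rcases ht : t.lab (u ++ [k]) with _ | b
      · rfl
      · simp [hs, ht] at h2
    · rcases ht : t.lab (u ++ [k]) with _ | b
      · simp [hs, ht] at h2
      · rw [hst _ a b hn hs ht]

theorem distBot_le_of_agree {s t : RTree α} {n : ℕ}
    (hst : ∀ u, u.length ≤ n → s.lab u = t.lab u) :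
    distBot (some s) (some t) ≤ (1 / 2 : ℝ) ^ n := by
  simp only [distBot]
  split_ifs with hN
  · positivity
  · obtain ⟨u, a, b, hu, ha, hb, hab⟩ := Nat.sInf_mem (Set.nonempty_iff_ne_empty.mpr hN)
    refine pow_le_pow_of_le_one (by norm_num) (by norm_num) ?_
    by_contra hlt
    have := hst u (by omega)
    rw [ha, hb] at this
    exact hab (by simpa using this)

theorem distBot_nonneg (s t : Option (RTree α)) : 0 ≤ distBot s t := by
  rcases s with _ | s <;> rcases t with _ | t <;> simp only [distBot]
  · exact le_rfl
  · exact zero_le_one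
  · exact zero_le_one
  · split_ifs <;> positivity

/-- The point `⊥` has distance `1` from every tree and is excluded by `(1 / 2) ^ n ≤ 1`. -/
theorem agree_of_distBot_lt {s : Option (RTree α)} {t : RTree α} {n : ℕ}
    (hst : distBot s (some t) < (1 / 2 : ℝ) ^ n) :
    ∃ s', s = some s' ∧ ∀ u, u.length ≤ n → s'.lab u = t.lab u := by
  rcases s with _ | s
  · have h1 : (1 / 2 : ℝ) ^ n ≤ 1 := pow_le_one₀ (by norm_num) (by norm_num)
    simp only [distBot] at hst
    linarith
  · refine ⟨s, rfl, lab_eq_of_agree fun u a b hu ha hb => ?_⟩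
    by_contra hab
    have hmem : u.length ∈ {n | ∃ u a b, u.length = n ∧ s.lab u = some a ∧
        t.lab u = some b ∧ a ≠ b} := ⟨u, a, b, rfl, ha, hb, hab⟩
    simp only [distBot] at hst
    rw [if_neg (Set.nonempty_iff_ne_empty.mp ⟨_, hmem⟩)] at hst
    have h1 := Nat.sInf_le hmem
    have h2 : (1 / 2 : ℝ) ^ n ≤ (1 / 2 : ℝ) ^ sInf {n | ∃ u a b, u.length = n ∧
        s.lab u = some a ∧ t.lab u = some b ∧ a ≠ b} :=
      pow_le_pow_of_le_one (by norm_num) (by norm_num) (h1.trans hu)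
    linarith

end RTree

/-! ### The limit of the sequence `γ_n(s)` -/

section Pieces

variable {α : Type*} {h : ℕ}

/-- One step of a walk through a tree composed of pieces: a pair `(c, v)` stands for the
position `v` of the piece `c`, and the walk enters the next piece as soon as it meets a hole. -/
def pieceStep {C : Type*} (L : C → List ℕ → Option (α ⊕ Fin h)) (nx : C → List ℕ → Fin h → C)
    (p : C × List ℕ) (k : ℕ) : C × List ℕ :=
  match L p.1 (p.2 ++ [k]) with
  | some (Sum.inr i) => (nx p.1 (p.2 ++ [k]) i, [])
  | _ => (p.1, p.2 ++ [k])

theorem pieceStep_hole {C : Type*} {L : C → List ℕ → Option (α ⊕ Fin h)}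
    {nx : C → List ℕ → Fin h → C} {p : C × List ℕ} {k : ℕ} {i : Fin h}
    (hL : L p.1 (p.2 ++ [k]) = some (Sum.inr i)) :
    pieceStep L nx p k = (nx p.1 (p.2 ++ [k]) i, []) := by
  simp [pieceStep, hL]

theorem pieceStep_noHole {C : Type*} {L : C → List ℕ → Option (α ⊕ Fin h)}
    {nx : C → List ℕ → Fin h → C} {p : C × List ℕ} {k : ℕ}
    (hL : ∀ i, L p.1 (p.2 ++ [k]) ≠ some (Sum.inr i)) :
    pieceStep L nx p k = (p.1, p.2 ++ [k]) := by
  unfold pieceStep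
  split
  · next i hi => exact absurd hi (hL i)
  · rfl

variable [RankedAlphabet α]

/-- The labelling of the pieces `γ u`. -/
def pieceLab (γ : List ℕ → Option (RTree (α ⊕ Fin h))) (u v : List ℕ) : Option (α ⊕ Fin h) :=
  (γ u).bind fun t => t.lab v

/-- The walk in the tree composed of the pieces `γ u` along a list of directions. -/
def walk (γ : List ℕ → Option (RTree (α ⊕ Fin h))) (p : List ℕ × List ℕ) (w : List ℕ) :
    List ℕ × List ℕ :=
  w.foldl (pieceStep (pieceLab γ) fun u _ i => u ++ [(i : ℕ)]) p

/-- The labelling of the tree composed of the pieces `γ u`. -/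
def walkLab (γ : List ℕ → Option (RTree (α ⊕ Fin h))) (w : List ℕ) : Option (α ⊕ Fin h) :=
  pieceLab γ (walk γ ([], []) w).1 (walk γ ([], []) w).2

/-- The positions whose pieces contribute to the composed tree. -/
inductive Reach (γ : List ℕ → Option (RTree (α ⊕ Fin h))) : List ℕ → Prop
  | nil : Reach γ []
  | snoc {u : List ℕ} {t : RTree (α ⊕ Fin h)} {i : Fin h} :
      Reach γ u → γ u = some t → i ∈ t.holes → Reach γ (u ++ [(i : ℕ)])

/-- All pieces that contribute exist and are different from holes. -/
def Guarded (γ : List ℕ → Option (RTree (α ⊕ Fin h))) : Prop :=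
  ∀ u, Reach γ u → ∃ t, γ u = some t ∧ ∀ i, t.lab [] ≠ some (Sum.inr i)

variable {γ : List ℕ → Option (RTree (α ⊕ Fin h))}

theorem pieceLab_some {u : List ℕ} {t : RTree (α ⊕ Fin h)} (hu : γ u = some t) (v : List ℕ) :
    pieceLab γ u v = t.lab v := by
  simp [pieceLab, hu]

theorem walk_nil (p : List ℕ × List ℕ) : walk γ p [] = p := rfl

theorem walk_append (p : List ℕ × List ℕ) (v w : List ℕ) :
    walk γ p (v ++ w) = walk γ (walk γ p v) w := by
  simp [walk]

theorem walk_snoc (p : List ℕ × List ℕ) (v : List ℕ) (k : ℕ) :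
    walk γ p (v ++ [k]) =
      pieceStep (pieceLab γ) (fun u _ i => u ++ [(i : ℕ)]) (walk γ p v) k := by
  simp [walk]

/-- Reconciles the walk, which extends piece indices at the end, with `choiceStage`, which recurses
on the first direction. -/
theorem walk_shift (i : ℕ) (w : List ℕ) : ∀ u v, walk γ (i :: u, v) w =
    (i :: (walk (fun u => γ (i :: u)) (u, v) w).1, (walk (fun u => γ (i :: u)) (u, v) w).2) := by
  induction w using List.reverseRecOn with
  | nil => intro u v; rfl
  | append_singleton w k ih =>
    intro u v
    rw [walk_snoc, walk_snoc, ih u v]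
    set p := walk (fun u => γ (i :: u)) (u, v) w
    have : pieceLab γ (i :: p.1) (p.2 ++ [k]) =
      pieceLab (fun u => γ (i :: u)) p.1 (p.2 ++ [k]) := rfl
    simp only [pieceStep, this]
    split <;> simp

/-- Inside of a piece, the walk follows the positions of this piece. -/
theorem walk_piece {u : List ℕ} {t : RTree (α ⊕ Fin h)} (hu : γ u = some t) {w : List ℕ}
    (hw : ∀ v j, v <+: w → t.lab v ≠ some (Sum.inr j)) : walk γ (u, []) w = (u, w) := by
  induction w using List.reverseRecOn with
  | nil => rfl
  | append_singleton w k ih =>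
    rw [walk_snoc, ih fun v j hv => hw v j (hv.trans (List.prefix_append _ _)), pieceStep_noHole]
    intro i
    simpa [pieceLab_some hu] using hw (w ++ [k]) i List.prefix_rfl

theorem noHole_of_prefix {t : RTree (α ⊕ Fin h)} {v w : List ℕ} {a : α ⊕ Fin h}
    (hw : t.lab w = some a) (hv : v <+: w) (hne : v ≠ w) (j : Fin h) :
    t.lab v ≠ some (Sum.inr j) := by
  rintro hj
  obtain ⟨w', rfl⟩ := hv
  have := t.eq_nil_of_hole hj (v := w') (by simp [hw])
  exact hne (by simp [this])

theorem walk_piece_inl {u : List ℕ} {t : RTree (α ⊕ Fin h)} (hu : γ u = some t) {w : List ℕ}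
    {a : α} (hw : t.lab w = some (Sum.inl a)) : walk γ (u, []) w = (u, w) := by
  refine walk_piece hu fun v j hv => ?_
  rcases eq_or_ne v w with rfl | hne
  · simp [hw]
  · exact noHole_of_prefix hw hv hne j

theorem walk_piece_inr {u : List ℕ} {t : RTree (α ⊕ Fin h)} (hu : γ u = some t)
    (hroot : ∀ i, t.lab [] ≠ some (Sum.inr i)) {w : List ℕ} {i : Fin h}
    (hw : t.lab w = some (Sum.inr i)) : walk γ (u, []) w = (u ++ [(i : ℕ)], []) := by
  rcases List.eq_nil_or_concat w with rfl | ⟨w, k, rfl⟩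
  · exact absurd hw (hroot i)
  · rw [List.concat_eq_append] at hw ⊢
    rw [walk_snoc, walk_piece hu, pieceStep_hole (i := i)]
    · simpa [pieceLab_some hu] using hw
    · intro v j hv
      refine noHole_of_prefix hw (hv.trans (List.prefix_append _ _)) ?_ j
      rintro rfl
      simpa using hv.length_le

theorem Reach.shift {t : RTree (α ⊕ Fin h)} {i : Fin h} (ht : γ [] = some t) (hi : i ∈ t.holes)
    {u : List ℕ} (hu : Reach (fun u => γ ((i : ℕ) :: u)) u) : Reach γ ((i : ℕ) :: u) := by
  induction hu with
  | nil => simpa using Reach.nil.snoc ht hi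
  | snoc hu ht' hj ih => simpa using ih.snoc ht' hj

theorem Guarded.shift (hG : Guarded γ) {t : RTree (α ⊕ Fin h)} {i : Fin h} (ht : γ [] = some t)
    (hi : i ∈ t.holes) : Guarded fun u => γ ((i : ℕ) :: u) :=
  fun _ hu => hG _ (hu.shift ht hi)

/-- Splits off the first direction instead of the last one, as needed for induction along
`choiceStage`. -/
theorem Reach.cons_inv {u : List ℕ} (hu : Reach γ u) : u = [] ∨ ∃ (t : RTree (α ⊕ Fin h))
    (i : Fin h) (u' : List ℕ), γ [] = some t ∧ i ∈ t.holes ∧ u = (i : ℕ) :: u' ∧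
      Reach (fun u => γ ((i : ℕ) :: u)) u' := by
  induction hu with
  | nil => exact Or.inl rfl
  | @snoc _ t i hu ht hi ih =>
    right
    rcases ih with rfl | ⟨t', j, u', ht', hj, rfl, hu'⟩
    · exact ⟨t, i, [], ht, hi, rfl, Reach.nil⟩
    · exact ⟨t', j, u' ++ [(i : ℕ)], ht', hj, by simp, hu'.snoc ht hi⟩

theorem graftBot_eq_some {t : RTree (α ⊕ Fin h)} {r : Fin h → Option (RTree (α ⊕ Fin h))}
    (hr : ∀ i ∈ t.holes, (r i).isSome) :
    RTree.graftBot (some t) r = some (t.graft fun i => (r i).getD (RTree.hole i)) := by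
  rw [RTree.graftBot, if_pos hr]

theorem isSome_of_graftBot {o : Option (RTree (α ⊕ Fin h))}
    {r : Fin h → Option (RTree (α ⊕ Fin h))} (ho : (RTree.graftBot o r).isSome) :
    ∃ t, o = some t ∧ ∀ i ∈ t.holes, (r i).isSome := by
  rcases o with _ | t
  · simp [RTree.graftBot] at ho
  · refine ⟨t, rfl, ?_⟩
    by_contra hne
    rw [RTree.graftBot, if_neg hne] at ho
    simp at ho

theorem choiceStage_isSome (n : ℕ) : ∀ γ : List ℕ → Option (RTree (α ⊕ Fin h)), Guarded γ →
    (choiceStage n γ).isSome := by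
  induction n with
  | zero =>
    intro γ hG
    obtain ⟨t, ht, -⟩ := hG [] Reach.nil
    simp [choiceStage, ht]
  | succ n ih =>
    intro γ hG
    obtain ⟨t, ht, -⟩ := hG [] Reach.nil
    rw [choiceStage, ht, graftBot_eq_some fun i hi => ih _ (hG.shift ht hi)]
    rfl

/-- Stage `n` already contains all contributing pieces up to depth `n`, and a missing one would turn
the whole stage into `⊥`. -/
theorem isSome_of_choiceStage (u : List ℕ) : ∀ (n : ℕ)
    (γ : List ℕ → Option (RTree (α ⊕ Fin h))), (choiceStage n γ).isSome → u.length ≤ n →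
      Reach γ u → (γ u).isSome := by
  induction u with
  | nil =>
    intro n γ hn _ _
    cases n with
    | zero => exact hn
    | succ n =>
      obtain ⟨t, ht, -⟩ := isSome_of_graftBot hn
      simp [ht]
  | cons k u ih =>
    intro n γ hn hle hu
    rcases hu.cons_inv with hu | ⟨t, i, u', ht, hi, heq, hu'⟩
    · simp at hu
    · obtain ⟨rfl, rfl⟩ : k = i ∧ u = u' := by simpa using heq
      cases n with
      | zero => simp at hle
      | succ n =>
        obtain ⟨t', ht', hsome⟩ := isSome_of_graftBot hn
        obtain rfl : t = t' := by simpa [ht] using ht'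
        exact ih n _ (hsome i hi) (by simpa using hle) hu'

/-- No piece is a bare hole, so entering a new piece uses up at least one direction. Hence a
position of length at most `n` lies in a piece of depth at most `n`, and later stages do not change
its label. -/
theorem choiceStage_lab (n : ℕ) : ∀ (γ : List ℕ → Option (RTree (α ⊕ Fin h)))
    (t : RTree (α ⊕ Fin h)), Guarded γ → choiceStage n γ = some t →
      ∀ w, w.length ≤ n → t.lab w = walkLab γ w := by
  induction n with
  | zero =>
    intro γ t hG ht w hw
    obtain rfl : w = [] := by simpa using hw
    exact (pieceLab_some ht []).symm
  | succ n ih =>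
    intro γ t hG ht w hw
    obtain ⟨t₀, ht₀, hroot⟩ := hG [] Reach.nil
    rw [choiceStage, ht₀, graftBot_eq_some fun i hi =>
      choiceStage_isSome n _ (hG.shift ht₀ hi)] at ht
    obtain rfl := Option.some.inj ht
    by_cases hole : ∃ v j, v <+: w ∧ t₀.lab v = some (Sum.inr j)
    · obtain ⟨v, i, ⟨w', rfl⟩, hv⟩ := hole
      have hi : i ∈ t₀.holes := ⟨v, hv⟩
      obtain ⟨r, hr⟩ := Option.isSome_iff_exists.mp (choiceStage_isSome n _ (hG.shift ht₀ hi))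
      have hne : v ≠ [] := by
        rintro rfl
        exact hroot i hv
      -- The hole sits strictly below the root, so the remainder `w'` is shorter than `w` and the
      -- smaller stage suffices.
      have hlen : w'.length ≤ n := by
        have := List.length_pos_iff.mpr hne
        simp at hw
        omega
      rw [RTree.graft_of_hole _ _ hv, hr, Option.getD_some, ih _ r (hG.shift ht₀ hi) hr w' hlen]
      simp only [walkLab]
      rw [walk_append, walk_piece_inr ht₀ hroot hv, List.nil_append, walk_shift]
      rfl
    · push Not at hole
      rw [RTree.graft_of_noHole _ _ hole]
      simp only [walkLab]
      rw [walk_piece ht₀ hole, pieceLab_some ht₀]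

/-- The limit of the sequence `γ_n(s)`. -/
def limitTree (hG : Guarded γ) : RTree (α ⊕ Fin h) where
  lab := walkLab γ
  root := by
    obtain ⟨t, ht⟩ := Option.isSome_iff_exists.mp (choiceStage_isSome 0 γ hG)
    rw [← choiceStage_lab 0 γ t hG ht [] (by simp)]
    exact t.root
  child u i := by
    obtain ⟨t, ht⟩ := Option.isSome_iff_exists.mp (choiceStage_isSome (u.length + 1) γ hG)
    rw [← choiceStage_lab _ γ t hG ht (u ++ [i]) (by simp),
      ← choiceStage_lab _ γ t hG ht u (by simp)]
    exact t.child u i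

theorem tendsto_limitTree (hG : Guarded γ) :
    Filter.Tendsto (fun n => RTree.distBot (choiceStage n γ) (some (limitTree hG)))
      Filter.atTop (nhds 0) := by
  refine squeeze_zero (fun n => RTree.distBot_nonneg _ _) (fun n => ?_)
    (tendsto_pow_atTop_nhds_zero_of_lt_one (r := (1 / 2 : ℝ)) (by norm_num) (by norm_num))
  obtain ⟨t, ht⟩ := Option.isSome_iff_exists.mp (choiceStage_isSome n γ hG)
  rw [ht]
  exact RTree.distBot_le_of_agree (choiceStage_lab n γ t hG ht)

theorem agree_of_tendsto {t : RTree (α ⊕ Fin h)}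
    (ht : Filter.Tendsto (fun n => RTree.distBot (choiceStage n γ) (some t))
      Filter.atTop (nhds 0)) (m : ℕ) :
    ∃ n s, m ≤ n ∧ choiceStage n γ = some s ∧ ∀ u, u.length ≤ m → s.lab u = t.lab u := by
  have h1 := (ht.eventually_lt_const (show (0 : ℝ) < (1 / 2) ^ m by positivity)).and
    (Filter.eventually_ge_atTop m)
  obtain ⟨n, hn, hmn⟩ := h1.exists
  obtain ⟨s, hs, hag⟩ := RTree.agree_of_distBot_lt hn
  exact ⟨n, s, hmn, hs, hag⟩

theorem isSome_of_tendsto {t : RTree (α ⊕ Fin h)}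
    (ht : Filter.Tendsto (fun n => RTree.distBot (choiceStage n γ) (some t))
      Filter.atTop (nhds 0)) {u : List ℕ} (hu : Reach γ u) : (γ u).isSome := by
  obtain ⟨n, s, hn, hs, -⟩ := agree_of_tendsto ht u.length
  exact isSome_of_choiceStage u n γ (by simp [hs]) hn hu

theorem lab_eq_of_tendsto {t : RTree (α ⊕ Fin h)} (hG : Guarded γ)
    (ht : Filter.Tendsto (fun n => RTree.distBot (choiceStage n γ) (some t))
      Filter.atTop (nhds 0)) (w : List ℕ) : t.lab w = walkLab γ w := by
  obtain ⟨n, s, hn, hs, hag⟩ := agree_of_tendsto ht w.length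
  rw [← hag w le_rfl, choiceStage_lab n γ s hG hs w hn]

end Pieces

/-! ### Least values that occur infinitely often -/

section LimInf

open Filter

/-- The number `c` is the least value that the sequence `a` takes infinitely often. -/
def IsLimInf (a : ℕ → ℕ) (c : ℕ) : Prop :=
  (∃ᶠ k in atTop, a k = c) ∧ ∀ᶠ k in atTop, c ≤ a k

theorem isLeast_frequently_iff {a : ℕ → ℕ} {c : ℕ} :
    IsLeast {c | ∃ᶠ k in atTop, a k = c} c ↔ IsLimInf a c := by
  refine ⟨fun ⟨h1, h2⟩ => ⟨h1, ?_⟩, fun ⟨h1, h2⟩ => ⟨h1, fun d hd => ?_⟩⟩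
  · have h3 : ∀ᶠ k in atTop, ∀ d ∈ Finset.range c, a k ≠ d := by
      rw [Filter.eventually_all_finset]
      intro d hd
      by_contra hne
      have : c ≤ d := h2 (show ∃ᶠ k in atTop, a k = d from hne)
      simp at hd
      omega
    filter_upwards [h3] with k hk
    by_contra hlt
    exact hk (a k) (by simpa using hlt) rfl
  · obtain ⟨k, hk1, hk2⟩ := (Filter.Frequently.and_eventually hd h2).exists
    omega

theorem exists_isLimInf {a : ℕ → ℕ} {N : ℕ} (ha : ∀ k, a k ≤ N) : ∃ c, IsLimInf a c := by
  classical
  have h1 : ∃ c, ∃ᶠ k in atTop, a k = c := by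
    by_contra hne
    push Not at hne
    have h3 : ∀ᶠ k in atTop, ∀ d ∈ Finset.range (N + 1), a k ≠ d := by
      rw [Filter.eventually_all_finset]
      intro d _
      simpa using hne d
    obtain ⟨k, hk⟩ := h3.exists
    exact hk (a k) (by simpa [Nat.lt_succ_iff] using ha k) rfl
  exact ⟨Nat.find h1, isLeast_frequently_iff.mp ⟨Nat.find_spec h1, fun d hd => Nat.find_min' h1 hd⟩⟩

theorem IsLimInf.of_shift {a : ℕ → ℕ} {c K : ℕ} (hc : IsLimInf (fun k => a (K + k)) c) :
    IsLimInf a c := by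
  obtain ⟨h1, h2⟩ := hc
  constructor
  · rw [Filter.frequently_atTop] at h1 ⊢
    intro n
    obtain ⟨k, hk, hak⟩ := h1 n
    exact ⟨K + k, by omega, hak⟩
  · rw [Filter.eventually_atTop] at h2 ⊢
    obtain ⟨n, hn⟩ := h2
    refine ⟨K + n, fun k hk => ?_⟩
    obtain ⟨l, rfl⟩ := Nat.exists_eq_add_of_le (show K ≤ k by omega)
    exact hn l (by omega)

/-- The least value of the sequence `a` on the interval from `p` to `q`. -/
noncomputable def segMin (a : ℕ → ℕ) (p q : ℕ) : ℕ := sInf {c | ∃ k, p ≤ k ∧ k ≤ q ∧ c = a k}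

theorem segMin_le {a : ℕ → ℕ} {p q k : ℕ} (hp : p ≤ k) (hq : k ≤ q) : segMin a p q ≤ a k :=
  Nat.sInf_le ⟨k, hp, hq, rfl⟩

theorem exists_eq_segMin {a : ℕ → ℕ} {p q : ℕ} (hpq : p ≤ q) :
    ∃ k, p ≤ k ∧ k ≤ q ∧ segMin a p q = a k :=
  Nat.sInf_mem (s := {c | ∃ k, p ≤ k ∧ k ≤ q ∧ c = a k}) ⟨a p, p, le_rfl, hpq, rfl⟩

/-- Late segments contain only values at least `c`, and every late occurrence of `c` lies in some
segment. That consecutive segments share an endpoint does no harm. -/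
theorem IsLimInf.segMin {a : ℕ → ℕ} {c : ℕ} (hc : IsLimInf a c) {j : ℕ → ℕ} (hj : StrictMono j) :
    IsLimInf (fun n => segMin a (j n) (j (n + 1))) c := by
  obtain ⟨h1, h2⟩ := hc
  have h3 : ∀ᶠ n in atTop, c ≤ _root_.segMin a (j n) (j (n + 1)) := by
    rw [Filter.eventually_atTop] at h2 ⊢
    obtain ⟨N, hN⟩ := h2
    refine ⟨N, fun n hn => ?_⟩
    obtain ⟨k, hk, -, heq⟩ := exists_eq_segMin (a := a) (hj (Nat.lt_add_one n)).le
    rw [heq]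
    exact hN k (hn.trans (hj.id_le n |>.trans hk))
  refine ⟨?_, h3⟩
  have h4 : ∃ᶠ n in atTop, _root_.segMin a (j n) (j (n + 1)) ≤ c := by
    rw [Filter.frequently_atTop] at h1 ⊢
    intro N
    obtain ⟨k, hk, rfl⟩ := h1 (j N)
    classical
    -- The least such `m` is of the form `n + 1` and gives the segment with `j n ≤ k < j (n + 1)`.
    have hex : ∃ m, k < j m := ⟨k + 1, hj.id_le (k + 1)⟩
    have hm := Nat.find_spec hex
    have hNm : N < Nat.find hex := hj.lt_iff_lt.mp (hk.trans_lt hm)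
    obtain ⟨n, hn⟩ : ∃ n, Nat.find hex = n + 1 := ⟨Nat.find hex - 1, by omega⟩
    have hjn : j n ≤ k := not_lt.mp (Nat.find_min hex (by omega))
    rw [hn] at hm
    exact ⟨n, by omega, segMin_le hjn hm.le⟩
  exact (h4.and_eventually h3).mono fun n hn => le_antisymm hn.1 hn.2

/-- Suppose that `d` is odd. Where `m k = d`, the order forces `n k` to be odd and at most `d`;
infinitely often also `c ≤ n k`, so `c < d`. Where `n k = c`, it forces `m k ≤ c`, which contradicts
that finally `d ≤ m k`. -/
theorem even_of_bestLE {m n : ℕ → ℕ} {c d : ℕ} (hmn : ∀ k, ParityNTA.BestLE (m k) (n k))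
    (hm : IsLimInf m d) (hn : IsLimInf n c) (hc : Even c) : Even d := by
  by_contra hd
  rw [Nat.not_even_iff_odd] at hd
  have hcd : c < d := by
    obtain ⟨k, hk, hck⟩ := (hm.1.and_eventually hn.2).exists
    have := hmn k
    rw [hk] at this
    rcases this with ⟨h1, -⟩ | ⟨h1, -⟩ | ⟨-, h1, h2⟩
    · exact absurd hd (by simpa using h1)
    · exact absurd hd (by simpa using h1)
    · have : c ≠ n k := by
        rintro rfl
        exact absurd h1 (by simpa using hc)
      omega
  obtain ⟨k, hk, hdk⟩ := (hn.1.and_eventually hm.2).exists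
  have := hmn k
  rw [hk] at this
  rcases this with ⟨-, h1⟩ | ⟨-, -, h1⟩ | ⟨-, h1, -⟩
  · exact absurd hc (by simpa using h1)
  · omega
  · exact absurd hc (by simpa using h1)

end LimInf

/-! ### Minimal colors of segments, and accepting runs by simulation -/

namespace ParityNTA

variable {Q α : Type*} [RankedAlphabet α] {h : ℕ}

theorem minColor_le (B : ParityNTA Q α) (ρ : List ℕ → Q) {v w : List ℕ} (hw : w <+: v) :
    B.minColor ρ v ≤ B.χ (ρ w) :=
  Nat.sInf_le ⟨w, hw, rfl⟩

theorem exists_eq_minColor (B : ParityNTA Q α) (ρ : List ℕ → Q) (v : List ℕ) :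
    ∃ w, w <+: v ∧ B.minColor ρ v = B.χ (ρ w) :=
  Nat.sInf_mem (s := {c : ℕ | ∃ w, w <+: v ∧ c = B.χ (ρ w)}) ⟨_, v, List.prefix_rfl, rfl⟩

theorem minColor_eq_segMin (B : ParityNTA Q α) (ρ : List ℕ → Q) (v : List ℕ) (a : ℕ → ℕ) (p : ℕ)
    (ha : ∀ d ≤ v.length, a (p + d) = B.χ (ρ (v.take d))) :
    B.minColor ρ v = segMin a p (p + v.length) := by
  apply le_antisymm
  · obtain ⟨k, hp, hq, hk⟩ := exists_eq_segMin (a := a) (Nat.le_add_right p v.length)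
    obtain ⟨d, rfl⟩ := Nat.exists_eq_add_of_le hp
    rw [hk, ha d (by omega)]
    exact B.minColor_le ρ (List.take_prefix _ _)
  · obtain ⟨w, hw, heq⟩ := B.exists_eq_minColor ρ v
    rw [heq, List.prefix_iff_eq_take.mp hw, ← ha _ hw.length_le]
    exact segMin_le (by omega) (by have := hw.length_le; omega)

theorem bestLE_refl (c : ℕ) : BestLE c c := by
  rcases Nat.even_or_odd c with hc | hc
  · exact Or.inr (Or.inl ⟨hc, hc, le_rfl⟩)
  · exact Or.inr (Or.inr ⟨hc, hc, le_rfl⟩)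

theorem isAccepting_iff (A : ParityNTA Q α) (t : RTree α) (ρ : List ℕ → Q) :
    A.IsAccepting t ρ ↔ ∀ u : ℕ → List ℕ, (∀ k, u k ∈ t.pos) →
      (∀ k, ∃ i, u (k + 1) = u k ++ [i]) →
        ∃ c : ℕ, Even c ∧ IsLimInf (fun k => (A.χ (ρ (u k)) : ℕ)) c := by
  simp only [IsAccepting, isLeast_frequently_iff]

/-- The colors along a strictly increasing sequence of positions of a tree with an accepting run,
divided into segments. -/
theorem isLimInf_segments (A : ParityNTA Q α) {t : RTree α} {ρ : List ℕ → Q}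
    (hacc : A.IsAccepting t ρ) {x y : ℕ → List ℕ} (hx : ∀ n, x n ∈ t.pos)
    (hxy : ∀ n, x (n + 1) = x n ++ y n) (hy : ∀ n, y n ≠ []) :
    ∃ c, Even c ∧ IsLimInf (fun n => A.minColor (fun w => ρ (x n ++ w)) (y n)) c := by
  have hmono : ∀ m n, m ≤ n → x m <+: x n := by
    intro m n hmn
    induction hmn with
    | refl => exact List.prefix_rfl
    | step _ ih => exact ih.trans (by rw [hxy]; exact List.prefix_append _ _)
  have hlen : StrictMono fun n => (x n).length := strictMono_nat_of_lt_succ fun n => by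
    have := List.length_pos_iff.mpr (hy n)
    simp [hxy n, this]
  have htake : ∀ m n k, k ≤ (x m).length → k ≤ (x n).length → (x m).take k = (x n).take k := by
    have aux : ∀ m n k, m ≤ n → k ≤ (x m).length → (x m).take k = (x n).take k := by
      intro m n k hmn hk
      obtain ⟨z, hz⟩ := hmono m n hmn
      rw [← hz, List.take_append_of_le_length hk]
    intro m n k hm hn
    rcases le_total m n with hmn | hmn
    · exact aux m n k hmn hm
    · exact (aux n m k hmn hn).symm
  have hge : ∀ n, n ≤ (x n).length := hlen.id_le
  rw [isAccepting_iff] at hacc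
  -- The `x n` are prefixes of one infinite path. Its `k`-th vertex can be read off from `x k`, the
  -- length of which is at least `k`.
  obtain ⟨c, hc, hlim⟩ := hacc (fun k => (x k).take k)
    (fun k => t.isSome_of_append (v := (x k).drop k) (by
      rw [List.take_append_drop]
      exact hx k)) (fun k => by
      have hk := hge (k + 1)
      refine ⟨(x (k + 1))[k], ?_⟩
      rw [htake k (k + 1) k (hge k) (by omega), List.take_concat_get' _ _ hk])
  refine ⟨c, hc, ?_⟩
  have := hlim.segMin hlen
  convert this using 2 with n
  rw [A.minColor_eq_segMin _ (y n) (fun k => (A.χ (ρ ((x k).take k)) : ℕ)) (x n).length]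
  · simp [hxy]
  · intro d hd
    rw [htake _ (n + 1) ((x n).length + d) (hge _) (by simp [hxy, hd]), hxy, List.take_append]
    simp [List.take_of_length_le]

/-- A tree composed of pieces has an accepting run, if its pieces have accepting runs that fit
together and the colors of which are controlled by a given accepting run on another tree. Here `C`
is the set of the occurrences of the pieces in the two trees: `c` stands for an occurrence of the
piece with index `u c`, entered in the state `st c`, that is matched with the position `x c`. -/
theorem exists_acceptingRun_of_simulation {Q' β : Type*} [RankedAlphabet β]
    (A : ParityNTA Q (α ⊕ Fin h)) (A' : ParityNTA Q' β)
    {γ : List ℕ → Option (RTree (α ⊕ Fin h))} {t : RTree (α ⊕ Fin h)}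
    (ht : ∀ w, t.lab w = walkLab γ w) {t' : RTree β} {ρ' : List ℕ → Q'}
    (hacc : A'.IsAccepting t' ρ') {C : Type*} (u x : C → List ℕ) (st : C → Q) (c₀ : C)
    (hc₀ : u c₀ = []) (hx : ∀ c, x c ∈ t'.pos)
    (hstep : ∀ c, ∃ (τ : RTree (α ⊕ Fin h)) (loc : List ℕ → Q), γ (u c) = some τ ∧
      (∀ i, τ.lab [] ≠ some (Sum.inr i)) ∧ loc [] = st c ∧ A.IsAccepting τ loc ∧
      (∀ v f, τ.lab v = some (Sum.inl f) →
        A.δ (loc v) (Sum.inl f) (fun j => loc (v ++ [(j : ℕ)]))) ∧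
      ∀ v i, τ.lab v = some (Sum.inr i) → ∃ c' y, u c' = u c ++ [(i : ℕ)] ∧ st c' = loc v ∧
        x c' = x c ++ y ∧ y ≠ [] ∧
        BestLE (A.minColor loc v) (A'.minColor (fun w => ρ' (x c ++ w)) y)) :
    ∃ ρ, A.AcceptingRun t (st c₀) ρ := by
  choose τ loc hτ hroot hloc hlacc hlrun hnext using hstep
  -- The successor occurrence is made total, with dummy values away from holes, so that it can serve
  -- as the argument `nx` of `pieceStep`.
  have hnext' : ∀ c v i, ∃ c' y, (τ c).lab v = some (Sum.inr i) → u c' = u c ++ [(i : ℕ)] ∧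
      st c' = loc c v ∧ x c' = x c ++ y ∧ y ≠ [] ∧
      BestLE (A.minColor (loc c) v) (A'.minColor (fun w => ρ' (x c ++ w)) y) := by
    intro c v i
    by_cases hv : (τ c).lab v = some (Sum.inr i)
    · obtain ⟨c', y, hc'⟩ := hnext c v i hv
      exact ⟨c', y, fun _ => hc'⟩
    · exact ⟨c, [], fun hv' => absurd hv' hv⟩
  choose nx y hnx using hnext'
  -- A refinement of `walk` that remembers the occurrence in `C` and not only the index of its
  -- piece; it determines which local run to use.
  let W : List ℕ → C × List ℕ := fun w =>
    w.foldl (pieceStep (fun c v => (τ c).lab v) nx) (c₀, [])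
  have hW : ∀ w k, W (w ++ [k]) = pieceStep (fun c v => (τ c).lab v) nx (W w) k := by
    intro w k
    simp [W]
  have hcases : ∀ w k, (∃ i, (τ (W w).1).lab ((W w).2 ++ [k]) = some (Sum.inr i) ∧
      W (w ++ [k]) = (nx (W w).1 ((W w).2 ++ [k]) i, [])) ∨
      ((∀ i, (τ (W w).1).lab ((W w).2 ++ [k]) ≠ some (Sum.inr i)) ∧
        W (w ++ [k]) = ((W w).1, (W w).2 ++ [k])) := by
    intro w k
    by_cases hi : ∃ i, (τ (W w).1).lab ((W w).2 ++ [k]) = some (Sum.inr i)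
    · obtain ⟨i, hi⟩ := hi
      exact Or.inl ⟨i, hi, by rw [hW, pieceStep_hole hi]⟩
    · push Not at hi
      exact Or.inr ⟨hi, by rw [hW, pieceStep_noHole hi]⟩
  have hwalk : ∀ w, walk γ ([], []) w = (u (W w).1, (W w).2) := by
    intro w
    induction w using List.reverseRecOn with
    | nil => simp [walk_nil, W, hc₀]
    | append_singleton w k ih =>
      rw [walk_snoc, ih]
      rcases hcases w k with ⟨i, hi, heq⟩ | ⟨hi, heq⟩
      · rw [heq, pieceStep_hole (i := i) (by simpa [pieceLab_some (hτ _)] using hi),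
          (hnx _ _ _ hi).1]
      · rw [heq, pieceStep_noHole (by simpa [pieceLab_some (hτ _)] using hi)]
  have hlab : ∀ w, t.lab w = (τ (W w).1).lab (W w).2 := by
    intro w
    rw [ht, walkLab, hwalk, pieceLab_some (hτ _)]
  have hnoHole : ∀ w i, (τ (W w).1).lab (W w).2 ≠ some (Sum.inr i) := by
    intro w
    induction w using List.reverseRecOn with
    | nil => exact hroot _
    | append_singleton w k ih =>
      rcases hcases w k with ⟨i, hi, heq⟩ | ⟨hi, heq⟩
      · rw [heq]
        exact hroot _
      · rw [heq]
        exact hi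
  let ρ : List ℕ → Q := fun w => loc (W w).1 (W w).2
  have hρ : ∀ w k, ρ (w ++ [k]) = loc (W w).1 ((W w).2 ++ [k]) := by
    intro w k
    simp only [ρ]
    rcases hcases w k with ⟨i, hi, heq⟩ | ⟨hi, heq⟩
    · rw [heq, hloc, (hnx _ _ _ hi).2.1]
    · rw [heq]
  refine ⟨ρ, fun w f hf => ?_, ?_, hloc c₀⟩
  · rw [hlab] at hf
    rcases f with f | i
    · have := hlrun _ _ _ hf
      simpa only [hρ] using this
    · exact absurd hf (hnoHole w i)
  rw [isAccepting_iff]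
  intro p hp hpath
  -- Either the path finally enters no new piece and is governed by a single local run, or it enters
  -- new pieces infinitely often.
  by_cases hfin : ∃ K, ∀ k, K ≤ k → (W (p (k + 1))).2 ≠ []
  · obtain ⟨K, hK⟩ := hfin
    have hst : ∀ k, K ≤ k → ∃ i, W (p (k + 1)) = ((W (p k)).1, (W (p k)).2 ++ [i]) := by
      intro k hk
      obtain ⟨i, hi⟩ := hpath k
      rcases hcases (p k) i with ⟨j, -, heq⟩ | ⟨-, heq⟩
      · exact absurd (by rw [hi, heq]) (hK k hk)
      · exact ⟨i, by rw [hi, heq]⟩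
    have hconst : ∀ k, (W (p (K + k))).1 = (W (p K)).1 := by
      intro k
      induction k with
      | zero => rfl
      | succ k ih =>
        obtain ⟨i, hi⟩ := hst (K + k) (by omega)
        rw [← add_assoc, hi, ih]
    obtain ⟨c, hc, hlim⟩ := (isAccepting_iff _ _ _).mp (hlacc (W (p K)).1)
      (fun k => (W (p (K + k))).2)
      (fun k => by
        have := hp (K + k)
        simp only [RTree.pos, Set.mem_ofPred_eq] at this ⊢
        rwa [hlab, hconst] at this)
      (fun k => by
        obtain ⟨i, hi⟩ := hst (K + k) (by omega)
        exact ⟨i, by rw [← add_assoc, hi]⟩)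
    refine ⟨c, hc, IsLimInf.of_shift (K := K) ?_⟩
    simpa only [ρ, hconst] using hlim
  · push Not at hfin
    have hinf : {k | (W (p k)).2 = []}.Infinite := by
      rw [Set.infinite_iff_exists_gt]
      intro K
      obtain ⟨k, hk, hk'⟩ := hfin K
      exact ⟨k + 1, hk', by omega⟩
    -- The times at which the path is at the root of a piece; they delimit the segments compared
    -- with the other tree.
    set j : ℕ → ℕ := Nat.nth fun k => (W (p k)).2 = [] with hj
    have hjmono : StrictMono j := Nat.nth_strictMono hinf
    have hjnil : ∀ n, (W (p (j n))).2 = [] := fun n => Nat.nth_mem_of_infinite hinf n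
    have hjne : ∀ n k, j n < k → k < j (n + 1) → (W (p k)).2 ≠ [] := by
      classical
      intro n k h1 h2 h3
      have h4 := Nat.nth_count (p := fun k => (W (p k)).2 = []) h3
      rw [← h4] at h1 h2
      have h5 := hjmono.lt_iff_lt.mp h1
      have h6 := hjmono.lt_iff_lt.mp h2
      omega
    let c : ℕ → C := fun n => (W (p (j n))).1
    let V : ℕ → ℕ → List ℕ := fun n d => (p (j n + d)).drop (p (j n)).length
    have hpV : ∀ n d, p (j n + d) = p (j n) ++ V n d := by
      intro n d
      have : p (j n) <+: p (j n + d) := by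
        induction d with
        | zero => exact List.prefix_rfl
        | succ d ih =>
          obtain ⟨i, hi⟩ := hpath (j n + d)
          rw [← add_assoc, hi]
          exact ih.trans (List.prefix_append _ _)
      obtain ⟨z, hz⟩ := this
      simp [V, ← hz]
    have hVsucc : ∀ n d, ∃ i, V n (d + 1) = V n d ++ [i] ∧ p (j n + d + 1) = p (j n + d) ++ [i] := by
      intro n d
      obtain ⟨i, hi⟩ := hpath (j n + d)
      refine ⟨i, ?_, hi⟩
      rw [add_assoc, hpV n (d + 1), hpV n d, List.append_assoc] at hi
      exact List.append_cancel_left hi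
    have hVlen : ∀ n d, (V n d).length = d := by
      intro n d
      induction d with
      | zero => simp [V]
      | succ d ih =>
        obtain ⟨i, hi, -⟩ := hVsucc n d
        simp [hi, ih]
    have hVW : ∀ n d, j n + d < j (n + 1) → W (p (j n + d)) = (c n, V n d) := by
      intro n d
      induction d with
      | zero =>
        intro _
        refine Prod.ext rfl ?_
        rw [List.eq_nil_of_length_eq_zero (hVlen n 0)]
        exact hjnil n
      | succ d ih =>
        intro hd
        obtain ⟨i, hi, hpi⟩ := hVsucc n d
        have h1 := ih (by omega)
        rcases hcases (p (j n + d)) i with ⟨j', -, heq⟩ | ⟨-, heq⟩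
        · refine absurd ?_ (hjne n (j n + (d + 1)) (by omega) hd)
          rw [← add_assoc, hpi, heq]
        · rw [← add_assoc, hpi, heq, h1, hi]
    have hend : ∀ n, ∃ i, (τ (c n)).lab (V n (j (n + 1) - j n)) = some (Sum.inr i) ∧
        c (n + 1) = nx (c n) (V n (j (n + 1) - j n)) i := by
      intro n
      have hlt := hjmono (Nat.lt_add_one n)
      obtain ⟨d, hd⟩ : ∃ d, j (n + 1) = j n + d + 1 := ⟨j (n + 1) - j n - 1, by omega⟩
      have hd' : j (n + 1) - j n = d + 1 := by omega
      obtain ⟨k, hk, hpk⟩ := hVsucc n d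
      have h1 := hVW n d (by omega)
      have h2 := hcases (p (j n + d)) k
      rw [← hpk, ← hd, h1, ← hk, ← hd'] at h2
      rcases h2 with ⟨i, hi, heq⟩ | ⟨-, heq⟩
      · exact ⟨i, hi, by simp only [c]; rw [heq]⟩
      · have h3 := hjnil (n + 1)
        rw [heq] at h3
        have h4 := hVlen n (j (n + 1) - j n)
        simp only at h3
        rw [h3] at h4
        simp at h4
        omega
    -- The right end is included: the state of the local run at a hole is the state in which the
    -- next occurrence is entered.
    have hρV : ∀ n d, d ≤ j (n + 1) - j n → ρ (p (j n + d)) = loc (c n) (V n d) := by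
      intro n d hd
      have hlt := hjmono (Nat.lt_add_one n)
      rcases hd.lt_or_eq with hd | rfl
      · simp only [ρ]
        rw [hVW n d (by omega)]
      · obtain ⟨i, hi, hci⟩ := hend n
        rw [show j n + (j (n + 1) - j n) = j (n + 1) by omega]
        simp only [ρ]
        rw [hjnil, hloc, ← (hnx _ _ _ hi).2.1, ← hci]
    choose e he hce using hend
    have hsrc := A'.isLimInf_segments hacc (x := fun n => x (c n))
      (y := fun n => y (c n) (V n (j (n + 1) - j n)) (e n)) (fun n => hx _)
      (fun n => by
        rw [hce n]
        exact (hnx _ _ _ (he n)).2.2.1)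
      (fun n => (hnx _ _ _ (he n)).2.2.2.1)
    obtain ⟨d, hd, hdlim⟩ := hsrc
    obtain ⟨b, hb⟩ := exists_isLimInf (a := fun k => (A.χ (ρ (p k)) : ℕ)) (N := A.numColors)
      (fun k => (A.χ _).2.2)
    refine ⟨b, ?_, hb⟩
    refine even_of_bestLE (fun n => ?_) (hb.segMin hjmono) hdlim hd
    have hseg : A.minColor (loc (c n)) (V n (j (n + 1) - j n)) =
        segMin (fun k => (A.χ (ρ (p k)) : ℕ)) (j n) (j (n + 1)) := by
      rw [A.minColor_eq_segMin _ _ (fun k => (A.χ (ρ (p k)) : ℕ)) (j n)]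
      · rw [hVlen, Nat.add_sub_cancel' (hjmono (Nat.lt_add_one n)).le]
      · intro d hd
        rw [hVlen] at hd
        rw [hρV n d hd]
        congr 3
        have h1 := hpV n (j (n + 1) - j n)
        have h2 : V n d <+: V n (j (n + 1) - j n) := by
          obtain ⟨l, hl⟩ := Nat.exists_eq_add_of_le hd
          rw [hl]
          clear hl hd
          induction l with
          | zero => exact List.prefix_rfl
          | succ l ih =>
            obtain ⟨i, hi, -⟩ := hVsucc n (d + l)
            rw [← add_assoc, hi]
            exact ih.trans (List.prefix_append _ _)
        rw [List.prefix_iff_eq_take.mp h2, hVlen]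
    rw [← hseg]
    exact (hnx _ _ _ (he n)).2.2.2.2

end ParityNTA

/-! ### Pieces that are chosen by substitutions -/

section Choices

variable {Λ α : Type*} [RankedAlphabet Λ] [RankedAlphabet α] {h : ℕ}

theorem RTree.lt_of_mem_holes_op {f : α} {hf : rk f ≤ h} {i : Fin h}
    (hi : i ∈ (RTree.op f hf).holes) : (i : ℕ) < rk f := by
  obtain ⟨u, hu⟩ := hi
  rcases u with _ | ⟨k, _ | ⟨l, u⟩⟩
  · simp [RTree.op] at hu
  · by_cases hk : k < rk f
    · simp [RTree.op, hk] at hu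
      simp [← hu, hk]
    · simp [RTree.op, hk] at hu
  · simp [RTree.op] at hu

theorem IsSubstitution.extendSubst {Ω : Type*} [RankedAlphabet Ω] {S X : Set Ω} {ι : S → α}
    (hι : ∀ f, rk (ι f) ≤ h) (hrk : ∀ f, rk (ι f) = rk f) {σ : X → Set (RTree (α ⊕ Fin h))}
    (hσ : IsSubstitution σ) : IsSubstitution (extendSubst ι hι σ) := by
  intro z t ht
  by_cases hz : z.1 ∈ X
  · rw [_root_.extendSubst, dif_pos hz] at ht
    exact hσ _ t ht
  · rw [_root_.extendSubst, dif_neg hz] at ht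
    obtain rfl := ht
    refine ⟨fun i hi => ?_, fun i => by simp [RTree.op]⟩
    have := RTree.lt_of_mem_holes_op hi
    rwa [hrk] at this

variable {σ : Λ → Set (RTree (α ⊕ Fin h))} {s : RTree Λ}
  {γ : List ℕ → Option (RTree (α ⊕ Fin h))}

theorem Reach.mem_pos (hσ : IsSubstitution σ) (hγ : IsChoice σ s γ) {u : List ℕ}
    (hu : Reach γ u) : u ∈ s.pos := by
  induction hu with
  | nil => exact s.root
  | @snoc u t i _ ht hi ih =>
    obtain ⟨x, hx⟩ := Option.isSome_iff_exists.mp ih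
    rcases hγ u x hx with ⟨t', ht', heq⟩ | ⟨-, heq⟩
    · obtain rfl : t = t' := by simpa [ht] using heq
      exact (s.child u i).mpr ⟨x, hx, (hσ x t ht').1 i hi⟩
    · simp [ht] at heq

theorem IsChoice.guarded (hσ : IsSubstitution σ) (hγ : IsChoice σ s γ)
    (hsome : ∀ u, Reach γ u → (γ u).isSome) : Guarded γ := by
  intro u hu
  obtain ⟨x, hx⟩ := Option.isSome_iff_exists.mp (hu.mem_pos hσ hγ)
  rcases hγ u x hx with ⟨t, ht, heq⟩ | ⟨-, heq⟩
  · exact ⟨t, heq, (hσ x t ht).2⟩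
  · have := hsome u hu
    simp [heq] at this

/-- The walk only visits contributing pieces, and the composed tree has no holes. -/
theorem Guarded.reach_walk_and_noHole (hG : Guarded γ) (w : List ℕ) :
    Reach γ (walk γ ([], []) w).1 ∧ ∀ i, walkLab γ w ≠ some (Sum.inr i) := by
  induction w using List.reverseRecOn with
  | nil =>
    refine ⟨Reach.nil, fun i => ?_⟩
    obtain ⟨t, ht, hroot⟩ := hG [] Reach.nil
    simpa [walkLab, walk_nil, pieceLab_some ht] using hroot i
  | append_singleton w k ih =>
    simp only [walkLab]
    rw [walk_snoc]
    set p := walk γ ([], []) w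
    by_cases hi : ∃ i, pieceLab γ p.1 (p.2 ++ [k]) = some (Sum.inr i)
    · obtain ⟨i, hi⟩ := hi
      rw [pieceStep_hole hi]
      obtain ⟨t, ht, -⟩ := hG _ ih.1
      have hr : Reach γ (p.1 ++ [(i : ℕ)]) :=
        ih.1.snoc ht ⟨p.2 ++ [k], by rw [← hi, pieceLab_some ht]⟩
      obtain ⟨t', ht', hroot⟩ := hG _ hr
      exact ⟨hr, fun j => by simpa [pieceLab_some ht'] using hroot j⟩
    · push Not at hi
      rw [pieceStep_noHole hi]
      exact ⟨ih.1, hi⟩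

theorem RTree.exists_addHoles_eq {t : RTree (α ⊕ Fin h)}
    (ht : ∀ u i, t.lab u ≠ some (Sum.inr i)) : ∃ t₀, RTree.addHoles h t₀ = t := by
  have hmap : ∀ u, ((t.lab u).bind Sum.getLeft?).map Sum.inl = t.lab u := by
    intro u
    rcases hu : t.lab u with _ | a | i
    · rfl
    · rfl
    · exact absurd hu (ht u i)
  have hsome : ∀ u, ((t.lab u).bind Sum.getLeft?).isSome = (t.lab u).isSome := by
    intro u
    rw [← congrArg Option.isSome (hmap u), Option.isSome_map]
  refine ⟨⟨fun u => (t.lab u).bind Sum.getLeft?, by rw [hsome]; exact t.root, fun u i => ?_⟩, ?_⟩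
  · rw [hsome, t.child]
    constructor
    · rintro ⟨a, ha, hi⟩
      rcases a with a | j
      · exact ⟨a, by simp [ha], hi⟩
      · exact absurd ha (ht u j)
    · rintro ⟨a, ha, hi⟩
      exact ⟨Sum.inl a, by rw [← hmap u, ha]; rfl, hi⟩
  · ext1
    funext u
    exact hmap u

end Choices

/-! ### Holes, the best-ordering, and least tasks -/

namespace ParityNTA

variable {Q α : Type*} [RankedAlphabet α] {h : ℕ}

theorem acceptingRun_addHoles_iff (B : ParityNTA Q α) (t : RTree α) (p : Q) (ρ : List ℕ → Q) :
    (B.withHoles h).AcceptingRun (RTree.addHoles h t) p ρ ↔ B.AcceptingRun t p ρ := by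
  refine and_congr ⟨fun hr u f hf => ?_, fun hr u f hf => ?_⟩ (and_congr ?_ Iff.rfl)
  · exact hr u (Sum.inl f) (by simp [RTree.addHoles, hf])
  · obtain ⟨g, hg, rfl⟩ : ∃ g, t.lab u = some g ∧ Sum.inl g = f := by
      simpa [RTree.addHoles] using hf
    exact hr u g hg
  · have : (RTree.addHoles h t).pos = t.pos := by
      ext u
      simp [RTree.pos, RTree.addHoles]
    simp only [IsAccepting, this]
    rfl

theorem isAccepting_of_bounded (A : ParityNTA Q α) {t : RTree α} {N : ℕ}
    (ht : ∀ u, (t.lab u).isSome → u.length ≤ N) (ρ : List ℕ → Q) : A.IsAccepting t ρ := by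
  intro u hu hpath
  have hlen : ∀ k, k ≤ (u k).length := by
    intro k
    induction k with
    | zero => simp
    | succ k ih =>
      obtain ⟨i, hi⟩ := hpath k
      simp [hi, ih]
  have h1 := hlen (N + 1)
  have h2 := ht _ (hu (N + 1))
  omega

theorem bestLE_zero {m : ℕ} (hm : BestLE m 0) : m = 0 := by
  rcases hm with ⟨-, h1⟩ | ⟨-, -, h1⟩ | ⟨-, h1, -⟩
  · simp at h1
  · omega
  · simp at h1

/-- Here `m` is the minimal color up to a hole in a piece, `c` the value that a task promises, and
`n` the minimal color through `t_π`, where the end states may lower `c` but never below `m`. If `m`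
is odd, then `c ≤ m`, so lowering leaves only `n = m`. -/
theorem BestLE.of_le {m n c : ℕ} (hm : BestLE m c) (hn : n ≤ c) (hmn : n = c ∨ m ≤ n) :
    BestLE m n := by
  rcases hmn with rfl | hmn
  · exact hm
  · rcases Nat.even_or_odd m with h1 | h1
    · rcases Nat.even_or_odd n with h2 | h2
      · exact Or.inr (Or.inl ⟨h1, h2, hmn⟩)
      · exact Or.inl ⟨h1, h2⟩
    · rcases hm with ⟨h2, -⟩ | ⟨h2, -⟩ | ⟨-, h2, h3⟩
      · exact absurd h1 (by simpa using h2)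
      · exact absurd h1 (by simpa using h2)
      · obtain rfl : n = m := by omega
        exact bestLE_refl n

theorem minColor_pos (B : ParityNTA Q α) (ρ : List ℕ → Q) (v : List ℕ) : 0 < B.minColor ρ v := by
  obtain ⟨w, -, heq⟩ := B.exists_eq_minColor ρ v
  rw [heq]
  exact (B.χ (ρ w)).2.1

theorem minColor_congr {Q' β : Type*} [RankedAlphabet β] (B : ParityNTA Q α) (A : ParityNTA Q' β)
    {ρ : List ℕ → Q} {ρ' : List ℕ → Q'} {v : List ℕ}
    (hv : ∀ w, w <+: v → (B.χ (ρ w) : ℕ) = A.χ (ρ' w)) : B.minColor ρ v = A.minColor ρ' v := by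
  simp only [minColor]
  congr 1
  ext c
  constructor
  · rintro ⟨w, hw, rfl⟩
    exact ⟨w, hw, hv w hw⟩
  · rintro ⟨w, hw, rfl⟩
    exact ⟨w, hw, (hv w hw).symm⟩

/-- A nonempty set of colors has a greatest element in the best-ordering. -/
theorem exists_bestLE_max {V : Set ℕ} (hV : V.Nonempty) {N : ℕ} (hN : ∀ c ∈ V, c ≤ N) :
    ∃ c ∈ V, ∀ d ∈ V, BestLE d c := by
  have hfin : V.Finite := (Set.finite_Iic N).subset hN
  by_cases hodd : ∃ c ∈ V, Odd c
  -- Odd numbers lie above even ones in reversed order, so the best element is the least odd one, or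
  -- the largest one if all are even.
  · obtain ⟨c, ⟨hc, hc'⟩, hmin⟩ := (hfin.subset (Set.sep_subset V Odd)).exists_minimalFor id _
      (by obtain ⟨c, hc, hc'⟩ := hodd; exact ⟨c, hc, hc'⟩)
    refine ⟨c, hc, fun d hd => ?_⟩
    rcases Nat.even_or_odd d with hd' | hd'
    · exact Or.inl ⟨hd', hc'⟩
    · refine Or.inr (Or.inr ⟨hd', hc', ?_⟩)
      by_contra hlt
      exact hlt (hmin (j := d) ⟨hd, hd'⟩ (not_le.mp hlt).le)
  · push Not at hodd
    obtain ⟨c, hc, hmax⟩ := hfin.exists_maximalFor id V hV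
    refine ⟨c, hc, fun d hd => Or.inr (Or.inl ⟨?_, ?_, ?_⟩)⟩
    · simpa using hodd d hd
    · simpa using hodd c hc
    · by_contra hlt
      exact hlt (hmax (j := d) hd (not_le.mp hlt).le)

/-- The least task that a run satisfies. -/
theorem exists_task (B : ParityNTA Q α) (t : RTree (α ⊕ Fin h)) (ρ : List ℕ → Q) :
    ∃ τ : B.Task h, τ.state = ρ [] ∧ B.Satisfies t ρ τ ∧ ∀ i q, τ.ψ i q ≠ 0 →
      ∃ v, t.lab v = some (Sum.inr i) ∧ ρ v = q ∧ B.minColor ρ v = τ.ψ i q := by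
  have key : ∀ i q, ∃ c : ℕ, (c = 0 ∨ ∃ q', c = B.χ q') ∧
      (∀ v, t.lab v = some (Sum.inr i) → ρ v = q → BestLE (B.minColor ρ v) c) ∧
      (c ≠ 0 → ∃ v, t.lab v = some (Sum.inr i) ∧ ρ v = q ∧ B.minColor ρ v = c) := by
    intro i q
    by_cases hex : ∃ v, t.lab v = some (Sum.inr i) ∧ ρ v = q
    · obtain ⟨c, ⟨v, hv, hv', rfl⟩, hmax⟩ := exists_bestLE_max
        (V := {c | ∃ v, t.lab v = some (Sum.inr i) ∧ ρ v = q ∧ B.minColor ρ v = c})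
        (by obtain ⟨v, hv⟩ := hex; exact ⟨_, v, hv.1, hv.2, rfl⟩) (N := B.numColors) (by
          rintro c ⟨v, -, -, rfl⟩
          obtain ⟨w, -, hw⟩ := B.exists_eq_minColor ρ v
          rw [hw]
          exact (B.χ (ρ w)).2.2)
      obtain ⟨w, -, hw⟩ := B.exists_eq_minColor ρ v
      exact ⟨_, Or.inr ⟨ρ w, hw⟩, fun v' h1 h2 => hmax _ ⟨v', h1, h2, rfl⟩,
        fun _ => ⟨v, hv, hv', rfl⟩⟩
    · push Not at hex
      exact ⟨0, Or.inl rfl, fun v h1 h2 => absurd h2 (hex v h1), fun h0 => absurd rfl h0⟩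
  choose ψ hmem hsat hattained using key
  exact ⟨⟨ρ [], ψ, hmem⟩, rfl, fun v i hv => hsat i _ v hv rfl, hattained⟩

theorem Satisfies.ψ_ne_zero {B : ParityNTA Q α} {t : RTree (α ⊕ Fin h)} {ρ : List ℕ → Q}
    {τ : B.Task h} (hτ : B.Satisfies t ρ τ) {v : List ℕ} {i : Fin h}
    (hv : t.lab v = some (Sum.inr i)) : τ.ψ i (ρ v) ≠ 0 := by
  intro h0
  have h1 := hτ v i hv
  rw [h0] at h1
  exact (B.minColor_pos ρ v).ne' (bestLE_zero h1)

/-- Only an inclusion, because an empty profile forgets the holes of `t`. -/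
theorem profHoles_subset (B : ParityNTA Q α) {t : RTree (α ⊕ Fin h)} {π : Set (B.Task h)}
    (hπ : π = B.profile t) :
    B.profHoles π ⊆ t.holes := by
  subst hπ
  intro i hi
  rwa [B.profHoles_profile t hi.1] at hi

/-! ### The trees `t_π` -/

section ProfTree

variable [Finite Q] (B : ParityNTA Q α)

/-- The hole below the child `k` of the root of `t_π`. -/
noncomputable def childIndex (π : B.profiles h) (k : Fin (Nat.card (Q × B.profHoles π.1))) :
    Q × B.profHoles π.1 :=
  (Finite.equivFin (Q × B.profHoles π.1)).symm k

theorem profTree_nil (π : B.profiles h) :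
    (B.profTree π).lab [] = some (Sum.inl (.prof π)) := rfl

theorem profTree_child (π : B.profiles h) (k : Fin (Nat.card (Q × B.profHoles π.1))) :
    (B.profTree π).lab [(k : ℕ)] = some (Sum.inl (.dollar (B.childIndex π k).2)) :=
  dif_pos k.2

theorem profTree_leaf (π : B.profiles h) (k : Fin (Nat.card (Q × B.profHoles π.1))) :
    (B.profTree π).lab [(k : ℕ), 0] = some (Sum.inr (B.childIndex π k).2.1) :=
  dif_pos ⟨k.2, rfl⟩

theorem profTree_inl {π : B.profiles h} {v : List ℕ} {a : B.ProfAlphabet h}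
    (hv : (B.profTree π).lab v = some (Sum.inl a)) : (v = [] ∧ a = .prof π) ∨
      ∃ k : Fin (Nat.card (Q × B.profHoles π.1)), v = [(k : ℕ)] ∧
        a = .dollar (B.childIndex π k).2 := by
  rcases v with _ | ⟨k, _ | ⟨l, _ | ⟨m, v⟩⟩⟩
  · left
    simpa [profTree, eq_comm] using hv
  · right
    by_cases hk : k < Nat.card (Q × B.profHoles π.1)
    · refine ⟨⟨k, hk⟩, rfl, ?_⟩
      rw [B.profTree_child π ⟨k, hk⟩] at hv
      simpa [eq_comm] using hv
    · simp only [profTree, dif_neg hk] at hv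
      simp at hv
  · by_cases hk : k < Nat.card (Q × B.profHoles π.1) ∧ l = 0
    · simp [profTree] at hv
    · simp only [profTree, dif_neg hk] at hv
      simp at hv
  · simp [profTree] at hv

theorem profTree_inr {π : B.profiles h} {v : List ℕ} {i : Fin h}
    (hv : (B.profTree π).lab v = some (Sum.inr i)) :
      ∃ k : Fin (Nat.card (Q × B.profHoles π.1)), v = [(k : ℕ), 0] ∧
        i = (B.childIndex π k).2 := by
  rcases v with _ | ⟨k, _ | ⟨l, _ | ⟨m, v⟩⟩⟩
  · simp [profTree] at hv
  · by_cases hk : k < Nat.card (Q × B.profHoles π.1)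
    · simp [profTree] at hv
    · simp only [profTree, dif_neg hk] at hv
      simp at hv
  · by_cases hk : k < Nat.card (Q × B.profHoles π.1) ∧ l = 0
    · obtain ⟨hk, rfl⟩ := hk
      refine ⟨⟨k, hk⟩, rfl, ?_⟩
      rw [B.profTree_leaf π ⟨k, hk⟩] at hv
      simpa [eq_comm] using hv
    · simp only [profTree, dif_neg hk] at hv
      simp at hv
  · simp [profTree] at hv

theorem profTree_length {π : B.profiles h} {v : List ℕ} (hv : ((B.profTree π).lab v).isSome) :
    v.length ≤ 2 := by
  rcases v with _ | ⟨k, _ | ⟨l, _ | ⟨m, v⟩⟩⟩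
  · simp
  · simp
  · simp
  · simp [profTree] at hv

theorem holes_profTree_subset (π : B.profiles h) : (B.profTree π).holes ⊆ B.profHoles π.1 := by
  rintro i ⟨v, hv⟩
  obtain ⟨k, -, rfl⟩ := B.profTree_inr hv
  exact (B.childIndex π k).2.2

/-- Without states the root `f_π` would have rank `0` and all holes would be lost. -/
theorem holes_profTree [Nonempty Q] (π : B.profiles h) :
    (B.profTree π).holes = B.profHoles π.1 := by
  refine (B.holes_profTree_subset π).antisymm fun i hi => ?_
  have hk := B.profTree_leaf π (Finite.equivFin _ (Classical.arbitrary Q, ⟨i, hi⟩))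
  exact ⟨_, by simpa [childIndex] using hk⟩

theorem isSubstitution_specialization {X : Type*} [RankedAlphabet X]
    {σ : X → Set (RTree (α ⊕ Fin h))} (hσ : IsSubstitution σ) :
    IsSubstitution (B.specialization σ) := by
  rintro x _ ⟨π, ⟨t, ht, hπ⟩, rfl⟩
  refine ⟨fun i hi => (hσ x t ht).1 i ?_, fun i => by simp [profTree_nil]⟩
  exact B.profHoles_subset hπ (B.holes_profTree_subset π hi)

end ProfTree

end ParityNTA

/-! ### Transfer of accepting runs between matched compositions -/

namespace ParityNTA

variable {Q α : Type*} [RankedAlphabet α] {h : ℕ} [Finite Q]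

/-- The pieces that a substitution and its specialization choose at a position. -/
inductive PieceRel (B : ParityNTA Q α) (hα : ∀ f : α, rk f ≤ h) :
    Option (RTree (α ⊕ Fin h)) → Option (RTree (B.ProfAlphabet h ⊕ Fin h)) → Prop
  | op (f : α) : PieceRel B hα (some (RTree.op f (hα f)))
      (some (RTree.op (α := B.ProfAlphabet h) (.base f) (hα f)))
  | prof (t : RTree (α ⊕ Fin h)) (π : B.profiles h) (hπ : π.1 = B.profile t) :
      PieceRel B hα (some t) (some (B.profTree π))
  | none : PieceRel B hα none none

theorem _root_.RTree.op_child {f : α} (hf : rk f ≤ h) (k : Fin (rk f)) :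
    (RTree.op f hf).lab [(k : ℕ)] = some (Sum.inr (k.castLE hf)) :=
  dif_pos k.2

theorem _root_.RTree.op_inl {f : α} {hf : rk f ≤ h} {v : List ℕ} {a : α}
    (hv : (RTree.op f hf).lab v = some (Sum.inl a)) : v = [] ∧ a = f := by
  rcases v with _ | ⟨k, _ | ⟨l, v⟩⟩
  · simpa [RTree.op, eq_comm] using hv
  · by_cases hk : k < rk f <;> simp [RTree.op, hk] at hv
  · simp [RTree.op] at hv

theorem _root_.RTree.op_inr {f : α} {hf : rk f ≤ h} {v : List ℕ} {i : Fin h}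
    (hv : (RTree.op f hf).lab v = some (Sum.inr i)) :
    ∃ k : Fin (rk f), v = [(k : ℕ)] ∧ i = k.castLE hf := by
  rcases v with _ | ⟨k, _ | ⟨l, v⟩⟩
  · simp [RTree.op] at hv
  · by_cases hk : k < rk f
    · refine ⟨⟨k, hk⟩, rfl, ?_⟩
      simpa [RTree.op, hk, eq_comm] using hv
    · simp [RTree.op, hk] at hv
  · simp [RTree.op] at hv

theorem _root_.RTree.op_length {f : α} {hf : rk f ≤ h} {v : List ℕ}
    (hv : ((RTree.op f hf).lab v).isSome) : v.length ≤ 1 := by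
  rcases v with _ | ⟨k, _ | ⟨l, v⟩⟩
  · simp
  · simp
  · simp [RTree.op] at hv

theorem _root_.RTree.holes_op_eq {β : Type*} [RankedAlphabet β] {f : α} {g : β} (hf : rk f ≤ h)
    (hg : rk g ≤ h) (hfg : rk f = rk g) : (RTree.op f hf).holes = (RTree.op g hg).holes := by
  ext i
  constructor
  · intro hi
    have := RTree.lt_of_mem_holes_op hi
    exact ⟨_, RTree.op_child hg ⟨i, by omega⟩⟩
  · intro hi
    have := RTree.lt_of_mem_holes_op hi
    exact ⟨_, RTree.op_child hf ⟨i, by omega⟩⟩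

variable {B : ParityNTA Q α} {hα : ∀ f : α, rk f ≤ h}
  {γ : List ℕ → Option (RTree (α ⊕ Fin h))}
  {γ' : List ℕ → Option (RTree (B.ProfAlphabet h ⊕ Fin h))}

theorem PieceRel.isSome_iff {o : Option (RTree (α ⊕ Fin h))}
    {o' : Option (RTree (B.ProfAlphabet h ⊕ Fin h))} (ho : PieceRel B hα o o') :
    o.isSome ↔ o'.isSome := by
  cases ho <;> simp

theorem PieceRel.holes_subset {t : RTree (α ⊕ Fin h)}
    {t' : RTree (B.ProfAlphabet h ⊕ Fin h)} (ht : PieceRel B hα (some t) (some t')) :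
    t'.holes ⊆ t.holes := by
  rcases ht with f | ⟨_, π, hπ⟩
  · exact (RTree.holes_op_eq (hα f) (g := (.base f : B.ProfAlphabet h)) (hα f) rfl).ge
  · exact (B.holes_profTree_subset π).trans (B.profHoles_subset hπ)

/-- Specializing a piece never adds holes. It may remove them, namely if the profile is empty, so
the converse needs an assumption. -/
theorem reach_of_reach_spec (hrel : ∀ u, Reach γ u → PieceRel B hα (γ u) (γ' u)) {u : List ℕ}
    (hu : Reach γ' u) : Reach γ u := by
  induction hu with
  | nil => exact Reach.nil
  | snoc _ ht hi ih =>
    have h1 := hrel _ ih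
    rw [ht] at h1
    obtain ⟨t, ht'⟩ := Option.isSome_iff_exists.mp (h1.isSome_iff.mpr rfl)
    rw [ht'] at h1
    exact ih.snoc ht' (h1.holes_subset hi)

theorem reach_spec_of_reach [Nonempty Q] (hrel : ∀ u, Reach γ u → PieceRel B hα (γ u) (γ' u))
    (hne : ∀ u t π, Reach γ u → γ u = some t → γ' u = some (B.profTree π) → t.holes.Nonempty →
      B.profile t ≠ ∅) {u : List ℕ} (hu : Reach γ u) : Reach γ' u := by
  induction hu with
  | nil => exact Reach.nil
  | @snoc u t i hu ht hi ih =>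
    have h1 := hrel _ hu
    rw [ht] at h1
    generalize ho : γ' u = o at h1
    rcases h1 with f | ⟨_, π, hπ⟩
    · exact ih.snoc ho 
        ((RTree.holes_op_eq (hα f) (g := (.base f : B.ProfAlphabet h)) (hα f) rfl).le hi)
    · refine ih.snoc ho ?_
      rw [B.holes_profTree, hπ, B.profHoles_profile t (hne u t π hu ht ho ⟨i, hi⟩)]
      exact hi

theorem walkLab_append {β : Type*} [RankedAlphabet β]
    {γ : List ℕ → Option (RTree (β ⊕ Fin h))} {x u w : List ℕ} {t : RTree (β ⊕ Fin h)} {a : β}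
    (hx : walk γ ([], []) x = (u, [])) (hu : γ u = some t) (hw : t.lab w = some (Sum.inl a)) :
    walkLab γ (x ++ w) = some (Sum.inl a) := by
  rw [walkLab, walk_append, hx, walk_piece_inl hu hw, pieceLab_some hu, hw]

theorem mem_pos_of_walk {β : Type*} [RankedAlphabet β]
    {γ : List ℕ → Option (RTree (β ⊕ Fin h))} {x u : List ℕ} {t t' : RTree (β ⊕ Fin h)}
    (ht : ∀ w, t.lab w = walkLab γ w) (hx : walk γ ([], []) x = (u, [])) (hu : γ u = some t') :
    x ∈ t.pos := by
  change (t.lab x).isSome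
  rw [ht, walkLab, hx, pieceLab_some hu]
  exact t'.root

/-- Each copy of `t_π` is replaced by the original piece with a run that satisfies the task chosen
by `B_P` at `f_π`. A leaf `i` reached in state `q` is matched with the path through the child in
state `(ψ_i(q), q, i)`. -/
theorem acceptingRun_of_spec (hG : Guarded γ) (hG' : Guarded γ')
    (hrel : ∀ u, Reach γ u → PieceRel B hα (γ u) (γ' u)) {t : RTree (α ⊕ Fin h)}
    (ht : ∀ w, t.lab w = walkLab γ w) {t' : RTree (B.ProfAlphabet h ⊕ Fin h)}
    (ht' : ∀ w, t'.lab w = walkLab γ' w) {q₀ : Q}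
    (hlang : t' ∈ (B.profAutomaton h).lang (Sum.inl q₀)) :
    ∃ ρ, (B.withHoles h).AcceptingRun t q₀ ρ := by
  obtain ⟨ρ', hrun, hacc, hroot⟩ := hlang
  -- An occurrence consists of a position of `t'` that is the root of a piece, the index of this
  -- piece, and the state of `ρ'` there.
  let C := {c : List ℕ × List ℕ × Q // Reach γ' c.2.1 ∧ walk γ' ([], []) c.1 = (c.2.1, []) ∧
    ρ' c.1 = Sum.inl c.2.2}
  refine exists_acceptingRun_of_simulation (B.withHoles h) (B.profAutomaton h) (C := C) ht hacc
    (fun c => c.1.2.1) (fun c => c.1.1) (fun c => c.1.2.2)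
    ⟨([], [], q₀), Reach.nil, rfl, hroot⟩ rfl ?_ ?_
  · rintro ⟨⟨x, u, q⟩, hu, hx, hq⟩
    obtain ⟨τ', hτ', -⟩ := hG' u hu
    exact mem_pos_of_walk ht' hx hτ'
  rintro ⟨⟨x, u, q⟩, hu, hx, hq⟩
  simp only at hu hx hq ⊢
  have hur := reach_of_reach_spec hrel hu
  obtain ⟨τ, hτ, hτroot⟩ := hG u hur
  obtain ⟨τ', hτ', hτroot'⟩ := hG' u hu
  have hR := hrel u hur
  rw [hτ, hτ'] at hR
  have htrans : ∀ w a, τ'.lab w = some (Sum.inl a) → (B.profAutomaton h).δ (ρ' (x ++ w))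
      (Sum.inl a) (fun j => ρ' (x ++ w ++ [(j : ℕ)])) := fun w a hw =>
    hrun (x ++ w) _ (by rw [ht', walkLab_append hx hτ' hw])
  rcases hR with f | ⟨_, π, hπ⟩
  · obtain ⟨q₁, p, hq₁, hp, hδ⟩ := htrans [] (.base f) rfl
    simp only [List.append_nil] at hq₁ hp
    obtain rfl : q = q₁ := by
      rw [hq] at hq₁
      exact Sum.inl.inj hq₁
    change Fin (rk f) → Q at p
    let loc : List ℕ → Q
      | [k] => if hk : k < rk f then p ⟨k, hk⟩ else q
      | _ => q
    have hloc : ∀ k : Fin (rk f), loc [(k : ℕ)] = p k := fun k => dif_pos k.2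
    refine ⟨_, loc, hτ, hτroot, rfl, isAccepting_of_bounded _ (fun _ => RTree.op_length) _, ?_, ?_⟩
    · rintro v g hv
      obtain ⟨rfl, rfl⟩ := RTree.op_inl hv
      change B.δ q g fun j : Fin (rk g) => loc [(j : ℕ)]
      simpa only [hloc] using hδ
    · intro v i hv
      obtain ⟨k, rfl, rfl⟩ := RTree.op_inr hv
      have hk' := RTree.op_child (α := B.ProfAlphabet h) (f := .base f) (hα f) k
      refine ⟨⟨(x ++ [(k : ℕ)], u ++ [(k : ℕ)], p k), hu.snoc hτ' ⟨_, hk'⟩, ?_, hp k⟩, [(k : ℕ)],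
        rfl, (hloc k).symm, rfl, by simp, ?_⟩
      · change walk γ' ([], []) (x ++ [(k : ℕ)]) = (u ++ [(k : ℕ)], [])
        rw [walk_append, hx, walk_piece_inr hτ' hτroot' hk']
        rfl
      · rw [minColor_congr (B.withHoles h) (B.profAutomaton h)
          (ρ' := fun w => ρ' (x ++ w)) (v := [(k : ℕ)])]
        · exact bestLE_refl _
        · intro w hw
          rcases List.prefix_concat_iff.mp (show w <+: [] ++ [(k : ℕ)] from hw) with rfl | hw
          · change _ = ((B.profAutomaton h).χ (ρ' (x ++ [(k : ℕ)])) : ℕ)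
            rw [hp k]
            change ((B.χ (loc [(k : ℕ)]) : Set.Icc 1 B.numColors) : ℕ) = B.χ (p k)
            rw [hloc]
          · obtain rfl := List.prefix_nil.mp hw
            simp only [List.append_nil]
            rw [hq]
            rfl
  · obtain ⟨σ, hσ, hσ₁, hrange⟩ := htrans [] (.prof π) (B.profTree_nil π)
    simp only [List.append_nil] at hσ₁ hrange
    obtain rfl : q = σ.state := by
      rw [hq] at hσ₁
      exact Sum.inl.inj hσ₁
    -- The transition at `f_π` exhibits a task in `π`, so `t_∅` cannot occur here and no hole of `τ`
    -- is lost in `t_π`.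
    have hne : B.profile τ ≠ ∅ := by
      rw [← hπ]
      exact Set.nonempty_iff_ne_empty.mp ⟨σ, hσ⟩
    have hσ' := hσ
    rw [hπ] at hσ'
    obtain ⟨loc, ⟨hlrun, hlacc, hlroot⟩, hsat⟩ := hσ'
    refine ⟨τ, loc, hτ, hτroot, hlroot, hlacc, fun v f hv => hlrun v _ hv, fun v i hv => ?_⟩
    have hψ := hsat.ψ_ne_zero hv
    have hi : i ∈ B.profHoles π.1 := by
      rw [hπ, B.profHoles_profile τ hne]
      exact ⟨v, hv⟩
    obtain ⟨q', hq'⟩ := (σ.mem i (loc v)).resolve_left hψ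
    have hmem : (Sum.inr (B.χ q', loc v, i) : Q ⊕ (Set.Icc 1 B.numColors × Q × Fin h)) ∈
        {r' | ∃ i ∈ B.profHoles π.1, ∃ q, ∃ c : Set.Icc 1 B.numColors,
            σ.ψ i q ≠ 0 ∧ (c : ℕ) = σ.ψ i q ∧ r' = Sum.inr (c, q, i)} :=
      ⟨i, hi, loc v, B.χ q', hψ, hq'.symm, rfl⟩
    rw [← hrange] at hmem
    obtain ⟨k, hk⟩ := hmem
    change Fin (Nat.card (Q × B.profHoles π.1)) at k
    obtain ⟨c₁, q₁, h₁, h₂⟩ := htrans [(k : ℕ)] (.dollar _) (B.profTree_child π k)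
    have h₃ := hk.symm.trans h₁
    simp only [Sum.inr.injEq, Prod.mk.injEq] at h₃
    obtain ⟨rfl, rfl, hik⟩ := h₃
    have h₂ := h₂ ⟨0, Nat.one_pos⟩
    simp only [List.append_assoc, List.cons_append, List.nil_append] at h₂
    have hleaf := B.profTree_leaf π k
    rw [← hik] at hleaf
    refine ⟨⟨(x ++ [(k : ℕ), 0], u ++ [(i : ℕ)], loc v), hu.snoc hτ' ⟨_, hleaf⟩, ?_, h₂⟩,
      [(k : ℕ), 0], rfl, rfl, rfl, by simp, ?_⟩
    · change walk γ' ([], []) (x ++ [(k : ℕ), 0]) = (u ++ [(i : ℕ)], [])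
      rw [walk_append, hx, walk_piece_inr hτ' hτroot' hleaf]
    · have hcol : ((B.profAutomaton h).χ (ρ' (x ++ [(k : ℕ)])) : ℕ) = σ.ψ i (loc v) := by
        rw [show ρ' (x ++ [(k : ℕ)]) = _ from hk, hq']
        rfl
      -- The path through `t_π` has three colors: the middle one is `ψ_i`, and the outer two are
      -- those of the root and the hole in `τ`, hence at least the minimal color in `τ`.
      refine BestLE.of_le (hsat v i hv) ?_ ?_
      · rw [← hcol]
        exact (B.profAutomaton h).minColor_le (fun w => ρ' (x ++ w)) (v := [(k : ℕ), 0]) ⟨[0], rfl⟩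
      · obtain ⟨w, hw, heq⟩ := (B.profAutomaton h).exists_eq_minColor (fun w => ρ' (x ++ w))
          [(k : ℕ), 0]
        rw [heq]
        rcases List.prefix_concat_iff.mp (show w <+: [(k : ℕ)] ++ [0] from hw) with rfl | hw
        · right
          simp only [List.cons_append, List.nil_append]
          rw [h₂]
          exact B.minColor_le loc List.prefix_rfl
        rcases List.prefix_concat_iff.mp (show w <+: [] ++ [(k : ℕ)] from hw) with rfl | hw
        · left
          exact hcol
        · right
          obtain rfl := List.prefix_nil.mp hw
          simp only [List.append_nil]
          rw [hq, ← hlroot]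
          exact B.minColor_le loc List.nil_prefix

/-- Each copy of a piece is replaced by `t_π`, with the least task satisfied by the restricted run.
Every nonzero `ψ_i(q)` is attained at some leaf, and the corresponding path of `t_π` is matched with
the path to such a leaf. -/
theorem mem_lang_of_acceptingRun (hG : Guarded γ) (hG' : Guarded γ')
    (hrel : ∀ u, Reach γ u → PieceRel B hα (γ u) (γ' u)) {t : RTree (α ⊕ Fin h)}
    (ht : ∀ w, t.lab w = walkLab γ w) {t' : RTree (B.ProfAlphabet h ⊕ Fin h)}
    (ht' : ∀ w, t'.lab w = walkLab γ' w) {q₀ : Q} {ρ : List ℕ → Q}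
    (hρ : (B.withHoles h).AcceptingRun t q₀ ρ) :
    t' ∈ (B.profAutomaton h).lang (Sum.inl q₀) := by
  obtain ⟨hrun, hacc, hroot⟩ := hρ
  let C := {c : List ℕ × List ℕ // Reach γ' c.2 ∧ walk γ ([], []) c.1 = (c.2, [])}
  rw [← hroot]
  refine exists_acceptingRun_of_simulation (B.profAutomaton h) (B.withHoles h) (C := C) ht' hacc
    (fun c => c.1.2) (fun c => c.1.1) (fun c => Sum.inl (ρ c.1.1))
    ⟨([], []), Reach.nil, rfl⟩ rfl ?_ ?_
  · rintro ⟨⟨x, u⟩, hu, hx⟩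
    obtain ⟨τ, hτ, -⟩ := hG u (reach_of_reach_spec hrel hu)
    exact mem_pos_of_walk ht hx hτ
  rintro ⟨⟨x, u⟩, hu, hx⟩
  simp only at hu hx ⊢
  have hur := reach_of_reach_spec hrel hu
  obtain ⟨τ, hτ, hτroot⟩ := hG u hur
  obtain ⟨τ', hτ', hτroot'⟩ := hG' u hu
  have hR := hrel u hur
  rw [hτ, hτ'] at hR
  have hwalk : ∀ v i, τ.lab v = some (Sum.inr i) →
      walk γ ([], []) (x ++ v) = (u ++ [(i : ℕ)], []) := fun v i hv => by
    rw [walk_append, hx, walk_piece_inr hτ hτroot hv]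
  have hlrun : (B.withHoles h).IsRun τ fun v => ρ (x ++ v) := by
    intro v f hv
    rcases f with f | i
    · simpa using hrun (x ++ v) (Sum.inl f) (by rw [ht, walkLab_append hx hτ hv])
    · trivial
  rcases hR with f | ⟨_, π, hπ⟩
  · refine ⟨_, fun v => Sum.inl (ρ (x ++ v)), hτ', hτroot', by simp,
      isAccepting_of_bounded _ (fun _ => RTree.op_length) _, ?_, ?_⟩
    · rintro v g hv
      obtain ⟨rfl, rfl⟩ := RTree.op_inl hv
      exact ⟨_, fun j => ρ (x ++ ([] ++ [(j : ℕ)])), rfl, fun j => rfl, hlrun [] _ rfl⟩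
    · intro v i hv
      obtain ⟨k, rfl, rfl⟩ := RTree.op_inr hv
      change Fin (rk f) at k
      refine ⟨⟨(x ++ [(k : ℕ)], u ++ [(k : ℕ)]), hu.snoc hτ' ⟨_, hv⟩,
        hwalk _ _ (RTree.op_child (hα f) k)⟩, [(k : ℕ)], rfl, rfl, rfl, by simp, ?_⟩
      rw [minColor_congr (B.profAutomaton h) (B.withHoles h) (ρ' := fun w => ρ (x ++ w))
        (v := [(k : ℕ)]) fun w _ => rfl]
      exact bestLE_refl _
  -- An infinite path in the piece meets no hole, since holes are leaves; so it is also a path of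
  -- the composed tree.
  · have hlacc : (B.withHoles h).IsAccepting τ fun v => ρ (x ++ v) := by
      intro w hw hpath
      refine hacc (fun k => x ++ w k) (fun k => ?_) (fun k => ?_)
      · obtain ⟨a, ha⟩ := Option.isSome_iff_exists.mp (hw k)
        rcases a with a | i
        · change (t.lab (x ++ w k)).isSome
          rw [ht, walkLab_append hx hτ ha]
          rfl
        · obtain ⟨j, hj⟩ := hpath k
          have h1 := hw (k + 1)
          rw [hj] at h1
          have := τ.eq_nil_of_hole ha h1
          simp at this
      · obtain ⟨j, hj⟩ := hpath k
        exact ⟨j, by rw [hj, List.append_assoc]⟩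
    obtain ⟨σ, hσ₁, hsat, hψ⟩ := B.exists_task τ fun v => ρ (x ++ v)
    simp only [List.append_nil] at hσ₁
    have hσ : σ ∈ B.profile τ := ⟨_, ⟨hlrun, hlacc, by simp [hσ₁]⟩, hsat⟩
    have hholes := B.profHoles_profile τ (Set.nonempty_iff_ne_empty.mp ⟨σ, hσ⟩)
    rw [← hπ] at hσ hholes
    have hchild : ∀ k : Fin (Nat.card (Q × B.profHoles π.1)), ∃ (q : Q) (v : List ℕ)
        (c : Set.Icc 1 B.numColors),
        (σ.ψ (B.childIndex π k).2 (B.childIndex π k).1 ≠ 0 → q = (B.childIndex π k).1) ∧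
        σ.ψ (B.childIndex π k).2 q ≠ 0 ∧ (c : ℕ) = σ.ψ (B.childIndex π k).2 q ∧
        τ.lab v = some (Sum.inr (B.childIndex π k).2.1) ∧ ρ (x ++ v) = q ∧
        B.minColor (fun v => ρ (x ++ v)) v = σ.ψ (B.childIndex π k).2 q := by
      intro k
      set q₁ := (B.childIndex π k).1
      set i := (B.childIndex π k).2
      -- The child with index `(q₁, i)` carries `q₁` if the task allows it. Otherwise it duplicates
      -- another admissible state for `i`, which exists because `i` occurs in `τ`; only the set of
      -- successor states matters.
      obtain ⟨q, hq, hq'⟩ : ∃ q, (σ.ψ i q₁ ≠ 0 → q = q₁) ∧ σ.ψ i q ≠ 0 := by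
        by_cases h0 : σ.ψ i q₁ = 0
        · have hi : (i : Fin h) ∈ τ.holes := by
            rw [← hholes]
            exact i.2
          obtain ⟨v, hv⟩ := hi
          exact ⟨ρ (x ++ v), fun h1 => absurd h0 h1, hsat.ψ_ne_zero hv⟩
        · exact ⟨q₁, fun _ => rfl, h0⟩
      obtain ⟨v, hv, hvq, hvc⟩ := hψ i q hq'
      obtain ⟨q₂, hq₂⟩ := (σ.mem i q).resolve_left hq'
      exact ⟨q, v, B.χ q₂, hq, hq', hq₂.symm, hv, hvq, hvc⟩
    choose q v c hq hne hc hv hvq hvc using hchild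
    let loc : List ℕ → Q ⊕ (Set.Icc 1 B.numColors × Q × Fin h)
      | [] => Sum.inl (ρ x)
      | [k] => if hk : k < Nat.card (Q × B.profHoles π.1) then
          Sum.inr (c ⟨k, hk⟩, q ⟨k, hk⟩, (B.childIndex π ⟨k, hk⟩).2) else Sum.inl (ρ x)
      | k :: _ :: _ => if hk : k < Nat.card (Q × B.profHoles π.1) then
          Sum.inl (q ⟨k, hk⟩) else Sum.inl (ρ x)
    have hloc₁ : ∀ k : Fin (Nat.card (Q × B.profHoles π.1)),
        loc [(k : ℕ)] = Sum.inr (c k, q k, (B.childIndex π k).2.1) := fun k => dif_pos k.2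
    have hloc₂ : ∀ (k : Fin (Nat.card (Q × B.profHoles π.1))) l,
        loc [(k : ℕ), l] = Sum.inl (q k) := fun k l => dif_pos k.2
    refine ⟨_, loc, hτ', hτroot', rfl, isAccepting_of_bounded _ (fun _ => B.profTree_length) _,
      ?_, ?_⟩
    · intro w a hw
      rcases B.profTree_inl hw with ⟨rfl, rfl⟩ | ⟨k, rfl, rfl⟩
      · refine ⟨σ, hσ, by rw [hσ₁], ?_⟩
        change Set.range (fun k : Fin (Nat.card (Q × B.profHoles π.1)) => loc [(k : ℕ)]) = _
        ext r
        constructor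
        · rintro ⟨k, rfl⟩
          exact ⟨_, (B.childIndex π k).2.2, q k, c k, hne k, hc k, hloc₁ k⟩
        · rintro ⟨i, hi, q', c', hψ', hc', rfl⟩
          obtain ⟨k, hk⟩ : ∃ k, B.childIndex π k = (q', ⟨i, hi⟩) :=
            (Finite.equivFin (Q × B.profHoles π.1)).symm.surjective _
          refine ⟨k, (hloc₁ k).trans ?_⟩
          have h1 := hq k
          have h2 := hc k
          rw [hk] at h1 h2
          have h3 := h1 hψ'
          rw [h3] at h2
          rw [hk, h3, Subtype.ext (h2.trans hc'.symm)]
      · exact ⟨c k, q k, hloc₁ k, fun j => hloc₂ k (j : ℕ)⟩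
    · intro w i hw
      obtain ⟨k, rfl, rfl⟩ := B.profTree_inr hw
      refine ⟨⟨(x ++ v k, u ++ [((B.childIndex π k).2.1 : ℕ)]), hu.snoc hτ' ⟨_, hw⟩,
        hwalk _ _ (hv k)⟩, v k, rfl, ?_, rfl, ?_, ?_⟩
      · simp only
        rw [hvq, hloc₂ k 0]
      · intro h0
        have := hv k
        rw [h0] at this
        exact hτroot _ this
      · have h1 : (B.withHoles h).minColor (fun w => ρ (x ++ w)) (v k) =
            σ.ψ (B.childIndex π k).2 (q k) := hvc k
        -- The two minimal colors coincide: `ψ_i` is attained at `v k`, so neither the root nor the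
        -- leaf of `t_π` has a smaller color.
        rw [h1, le_antisymm (a := (B.profAutomaton h).minColor loc [(k : ℕ), 0])
          (b := σ.ψ (B.childIndex π k).2 (q k))]
        · exact bestLE_refl _
        · have := (B.profAutomaton h).minColor_le loc (v := [(k : ℕ), 0]) (w := [(k : ℕ)]) ⟨[0], rfl⟩
          rw [hloc₁] at this
          exact this.trans (hc k).le
        · obtain ⟨w, hw, heq⟩ := (B.profAutomaton h).exists_eq_minColor loc [(k : ℕ), 0]
          rw [heq]
          rcases List.prefix_concat_iff.mp (show w <+: [(k : ℕ)] ++ [0] from hw) with rfl | hw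
          · simp only [List.cons_append, List.nil_append]
            rw [hloc₂ k 0, ← hvc, ← hvq]
            exact B.minColor_le (fun w => ρ (x ++ w)) List.prefix_rfl
          rcases List.prefix_concat_iff.mp (show w <+: [] ++ [(k : ℕ)] from hw) with rfl | hw
          · simp only [List.nil_append]
            rw [hloc₁]
            exact (hc k).ge
          · obtain rfl := List.prefix_nil.mp hw
            rw [← hvc]
            have := B.minColor_le (fun w => ρ (x ++ w)) (v := v k) (w := []) List.nil_prefix
            simp only [List.append_nil] at this
            exact this

end ParityNTA

/-! ### Matching of choice functions, and the proposition -/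

section Specialization

variable {Ω Q : Type*} [RankedAlphabet Ω] [Finite Q] {S X : Set Ω} {h : ℕ}
  {hS : ∀ f : S, rk f ≤ h} {B : ParityNTA Q S} {σ : X → Set (RTree (S ⊕ Fin h))}
  {s : RTree ↥(S ∪ X)}

theorem exists_specialized_choice {γ : List ℕ → Option (RTree (S ⊕ Fin h))}
    (hγ : IsChoice (extendSubst id hS σ) s γ) :
    ∃ γ', IsChoice (extendSubst ParityNTA.ProfAlphabet.base hS (B.specialization σ)) s γ' ∧
      ∀ u ∈ s.pos, B.PieceRel hS (γ u) (γ' u) := by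
  have key : ∀ u, ∃ o, ∀ z, s.lab u = some z →
      ((∃ t ∈ extendSubst ParityNTA.ProfAlphabet.base hS (B.specialization σ) z, o = some t) ∨
        (extendSubst ParityNTA.ProfAlphabet.base hS (B.specialization σ) z = ∅ ∧ o = none)) ∧
      B.PieceRel hS (γ u) o := by
    intro u
    rcases hu : s.lab u with _ | z
    · exact ⟨none, by simp⟩
    have h1 := hγ u z hu
    simp only [Option.some.injEq, forall_eq', extendSubst] at h1 ⊢
    split_ifs at h1 ⊢ with hz
    · rcases h1 with ⟨t, ht, hγu⟩ | ⟨hemp, hγu⟩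
      · rw [hγu]
        exact ⟨_, Or.inl ⟨_, ⟨⟨B.profile t, Or.inr ⟨t, rfl⟩⟩, ⟨t, ht, rfl⟩, rfl⟩, rfl⟩,
          .prof t _ rfl⟩
      · rw [hγu]
        refine ⟨none, Or.inr ⟨?_, rfl⟩, .none⟩
        rw [Set.eq_empty_iff_forall_notMem]
        rintro _ ⟨π, ⟨t, ht, -⟩, -⟩
        simp [hemp] at ht
    · rcases h1 with ⟨t, ht, hγu⟩ | ⟨hemp, -⟩
      · rw [Set.mem_singleton_iff.mp ht] at hγu
        rw [hγu]
        exact ⟨_, Or.inl ⟨_, rfl, rfl⟩, .op _⟩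
      · simp at hemp
  choose γ' hγ' using key
  refine ⟨γ', fun u z hu => (hγ' u z hu).1, fun u hu => ?_⟩
  obtain ⟨z, hz⟩ := Option.isSome_iff_exists.mp hu
  exact (hγ' u z hz).2

/-- Several trees of `σ(x)` may share a profile; any tree with the profile chosen by `γ'` serves, as
the transfer of runs depends on profiles only. -/
theorem exists_unspecialized_choice {γ' : List ℕ → Option (RTree (B.ProfAlphabet h ⊕ Fin h))}
    (hγ' : IsChoice (extendSubst ParityNTA.ProfAlphabet.base hS (B.specialization σ)) s γ') :
    ∃ γ, IsChoice (extendSubst id hS σ) s γ ∧ ∀ u ∈ s.pos, B.PieceRel hS (γ u) (γ' u) := by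
  have key : ∀ u, ∃ o, ∀ z, s.lab u = some z →
      ((∃ t ∈ extendSubst id hS σ z, o = some t) ∨
        (extendSubst id hS σ z = ∅ ∧ o = none)) ∧ B.PieceRel hS o (γ' u) := by
    intro u
    rcases hu : s.lab u with _ | z
    · exact ⟨none, by simp⟩
    have h1 := hγ' u z hu
    simp only [Option.some.injEq, forall_eq', extendSubst] at h1 ⊢
    split_ifs at h1 ⊢ with hz
    · rcases h1 with ⟨_, ⟨π, ⟨t, ht, hπ⟩, rfl⟩, hγu⟩ | ⟨hemp, hγu⟩
      · rw [hγu]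
        exact ⟨_, Or.inl ⟨t, ht, rfl⟩, .prof t π hπ⟩
      · rw [hγu]
        refine ⟨none, Or.inr ⟨?_, rfl⟩, .none⟩
        rw [Set.eq_empty_iff_forall_notMem]
        intro t ht
        rw [Set.eq_empty_iff_forall_notMem] at hemp
        exact hemp _ ⟨⟨B.profile t, Or.inr ⟨t, rfl⟩⟩, ⟨t, ht, rfl⟩, rfl⟩
    · rcases h1 with ⟨t, ht, hγu⟩ | ⟨hemp, -⟩
      · rw [Set.mem_singleton_iff.mp ht] at hγu
        rw [hγu]
        exact ⟨_, Or.inl ⟨_, rfl, rfl⟩, .op _⟩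
      · simp at hemp
  choose γ hγ using key
  refine ⟨γ, fun u z hu => (hγ u z hu).1, fun u hu => ?_⟩
  obtain ⟨z, hz⟩ := Option.isSome_iff_exists.mp hu
  exact (hγ u z hz).2

/-- If `γ` has a limit, then so has `γ'`, because it reaches no further pieces. The limit of `γ'` is
accepted by assumption, and its run is transferred back. -/
theorem ioExt_subset_of_specialization (hσ : IsSubstitution σ) {q₀ : Q}
    (hs : ioExt (extendSubst ParityNTA.ProfAlphabet.base hS (B.specialization σ)) s
      ⊆ (B.profAutomaton h).lang (Sum.inl q₀)) :
    ioExt (extendSubst id hS σ) s ⊆ RTree.addHoles h '' B.lang q₀ := by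
  rintro t ⟨γ, hγ, hlim⟩
  have hσ₁ : IsSubstitution (extendSubst id hS σ) := hσ.extendSubst hS fun _ => rfl
  have hσ₂ : IsSubstitution (extendSubst ParityNTA.ProfAlphabet.base hS (B.specialization σ)) :=
    IsSubstitution.extendSubst (ι := ParityNTA.ProfAlphabet.base) hS (fun _ => rfl)
      (B.isSubstitution_specialization hσ)
  obtain ⟨γ', hγ', hrel⟩ := exists_specialized_choice (B := B) hγ
  have hrel' : ∀ u, Reach γ u → B.PieceRel hS (γ u) (γ' u) :=
    fun u hu => hrel u (hu.mem_pos hσ₁ hγ)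
  have hG : Guarded γ := hγ.guarded hσ₁ fun u hu => isSome_of_tendsto hlim hu
  have hG' : Guarded γ' := hγ'.guarded hσ₂ fun u hu => by
    have hu' := ParityNTA.reach_of_reach_spec hrel' hu
    exact (hrel' u hu').isSome_iff.mp (isSome_of_tendsto hlim hu')
  have hlab := lab_eq_of_tendsto hG hlim
  obtain ⟨ρ, hρ⟩ := ParityNTA.acceptingRun_of_spec hG hG' hrel' hlab (t' := limitTree hG')
    (fun _ => rfl) (hs ⟨γ', hγ', tendsto_limitTree hG'⟩)
  obtain ⟨t₀, rfl⟩ := RTree.exists_addHoles_eq (t := t) fun u i => by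
    rw [hlab]
    exact (hG.reach_walk_and_noHole u).2 i
  exact ⟨t₀, ⟨ρ, (B.acceptingRun_addHoles_iff t₀ q₀ ρ).mp hρ⟩, rfl⟩

/-- The assumption `hne` is used only to show that `γ` has a limit whenever `γ'` has one; the
transfer of runs needs no more. -/
theorem ioExt_specialization_subset (hσ : IsSubstitution σ) {q₀ : Q}
    (hne : (∀ x, (σ x).Nonempty) ∨ ∀ x, ∀ t ∈ σ x, t.holes.Nonempty → B.profile t ≠ ∅)
    (hs : ioExt (extendSubst id hS σ) s ⊆ RTree.addHoles h '' B.lang q₀) :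
    ioExt (extendSubst ParityNTA.ProfAlphabet.base hS (B.specialization σ)) s
      ⊆ (B.profAutomaton h).lang (Sum.inl q₀) := by
  rintro t' ⟨γ', hγ', hlim⟩
  have hσ₁ : IsSubstitution (extendSubst id hS σ) := hσ.extendSubst hS fun _ => rfl
  have hσ₂ : IsSubstitution (extendSubst ParityNTA.ProfAlphabet.base hS (B.specialization σ)) :=
    IsSubstitution.extendSubst (ι := ParityNTA.ProfAlphabet.base) hS (fun _ => rfl)
      (B.isSubstitution_specialization hσ)
  obtain ⟨γ, hγ, hrel⟩ := exists_unspecialized_choice hγ'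
  have hrel' : ∀ u, Reach γ u → B.PieceRel hS (γ u) (γ' u) :=
    fun u hu => hrel u (hu.mem_pos hσ₁ hγ)
  have hG' : Guarded γ' := hγ'.guarded hσ₂ fun u hu => isSome_of_tendsto hlim hu
  have hG : Guarded γ := hγ.guarded hσ₁ fun u hu => by
    obtain ⟨z, hz⟩ := Option.isSome_iff_exists.mp (hu.mem_pos hσ₁ hγ)
    -- In the first case no choice is ever `⊥`. In the second one `γ` and `γ'` reach the same
    -- positions, and `γ'` has pieces at all of them.
    rcases hne with hne | hne
    · rcases hγ u z hz with ⟨t, -, ht⟩ | ⟨hemp, -⟩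
      · simp [ht]
      · simp only [extendSubst] at hemp
        split_ifs at hemp with hzX
        · exact absurd hemp (hne _).ne_empty
        · simp at hemp
    · refine (hrel' u hu).isSome_iff.mpr (isSome_of_tendsto hlim ?_)
      have : Nonempty Q := ⟨q₀⟩
      refine ParityNTA.reach_spec_of_reach hrel' (fun v t π hv ht hπ hhole => ?_) hu
      obtain ⟨z, hz⟩ := Option.isSome_iff_exists.mp (hv.mem_pos hσ₁ hγ)
      rcases hγ v z hz with ⟨t₁, ht₁, heq⟩ | ⟨-, heq⟩
      · obtain rfl : t = t₁ := by simpa [ht] using heq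
        by_cases hzX : z.1 ∈ X
        · rw [extendSubst, dif_pos hzX] at ht₁
          exact hne _ t ht₁ hhole
        -- For a symbol outside `X` the piece of `γ'` has a root in `Σ`, so it cannot be some `t_π`.
        · rcases hγ' v z hz with ⟨t₂, ht₂, heq₂⟩ | ⟨-, heq₂⟩
          · rw [extendSubst, dif_neg hzX, Set.mem_singleton_iff] at ht₂
            obtain rfl := Option.some.inj (hπ.symm.trans heq₂)
            have := congrArg (fun t => t.lab []) ht₂
            simp [ParityNTA.profTree_nil, RTree.op] at this
          · simp [hπ] at heq₂
      · simp [ht] at heq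
  obtain ⟨t₀, ⟨ρ, hρ⟩, ht₀⟩ := hs ⟨γ, hγ, tendsto_limitTree hG⟩
  rw [← B.acceptingRun_addHoles_iff (h := h), ht₀] at hρ
  exact ParityNTA.mem_lang_of_acceptingRun hG hG' hrel' (fun _ => rfl)
    (lab_eq_of_tendsto hG' hlim) hρ

end Specialization

theorem mainTheorem8 {Ω Q : Type*} [RankedAlphabet Ω] [Finite Ω] [Finite Q] (S X : Set Ω) (h : ℕ)
    (hS : ∀ f : S, RankedAlphabet.rk f ≤ h) (hX : ∀ x : X, RankedAlphabet.rk x ≤ h)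
    (B : ParityNTA Q S) (q₀ : Q)
    (σ : X → Set (RTree (S ⊕ Fin h))) (hσ : IsSubstitution σ) :
    ({s : RTree ↥(S ∪ X) |
        ioExt (extendSubst ParityNTA.ProfAlphabet.base hS (B.specialization σ)) s
          ⊆ (B.profAutomaton h).lang (Sum.inl q₀)}
      ⊆ {s : RTree ↥(S ∪ X) |
          ioExt (extendSubst id hS σ) s ⊆ RTree.addHoles h '' B.lang q₀}) ∧
    (((∀ x, (σ x).Nonempty) ∨ (∀ x, ∀ t ∈ σ x, t.holes.Nonempty → B.profile t ≠ ∅)) →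
      {s : RTree ↥(S ∪ X) |
          ioExt (extendSubst id hS σ) s ⊆ RTree.addHoles h '' B.lang q₀}
        = {s : RTree ↥(S ∪ X) |
            ioExt (extendSubst ParityNTA.ProfAlphabet.base hS (B.specialization σ)) s
              ⊆ (B.profAutomaton h).lang (Sum.inl q₀)}) := by
  refine ⟨fun s hs => ioExt_subset_of_specialization hσ hs, fun hne => Set.ext fun s => ?_⟩
  exact ⟨fun hs => ioExt_specialization_subset hσ hne hs,
    fun hs => ioExt_subset_of_specialization hσ hs⟩
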